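/- Let $m\ge 1$, let $X=(X_i)_{i\ge1}$ and $Y=(Y_i)_{i\ge1}$ be two independent sequences of iid random variables with values in a finite alphabet $\mathcal{A}_m=\{\alpha_1,\dots,\alpha_m\}$, with $\mathbb{P}(X_i=\alpha_k)=\mathbb{P}(Y_i=\alpha_k)=p_k$ for all $i\ge 1$ and $1\le k\le m$. For words $x,y$ of length $n$, let $LC_n(x;y)$ be the length of their longest common subsequence, i.e. the largest $k$ for which there are $1\le i_1<\dots<i_k\le n$ and $1\le j_1<\dots<j_k\le n$ with $x_{i_s}=y_{j_s}$ for $s=1,\dots,k$, and let $LC_n=LC_n(X_1\cdots X_n;Y_1\cdots Y_n)$. Put $$K_0=2^{-4}\,10^{-2}e^{-67},\qquad K=\min\Bigl(K_0,\frac{1}{800m}\Bigr).$$ Assume that $p_{j_0}>1/2$ for some $j_0\in\{1,\dots,m\}$ and that $$\max_{j\ne j_0}p_j\le\min\Bigl(\frac{2^{-2}e^{-5}K}{m},\frac{K}{2m^2}\Bigr)$$ (the maximum over the empty set being $0$). Given $n\ge1$ and the words $X_1\cdots X_n$ and $Y_1\cdots Y_n$, pick a position uniformly at random among all positions of the two words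 whose letter is not $\alpha_{j_0}$, change the letter at this position into $\alpha_{j_0}$, and let $\widetilde{LC_n}$ be the length of the longest common subsequence of the two new words (if there is no such position, then $\widetilde{LC_n}=LC_n$). Then, for every $n\ge 1$, there is a set $\mathcal{B}_n\subset\mathcal{A}_m^n\times\mathcal{A}_m^n$ such that $$\mathbb{P}\bigl((X_1\cdots X_n,Y_1\cdots Y_n)\in\mathcal{B}_n\bigr)\ge 1-121\exp\Bigl(-\frac{n(\max_{j\ne j_0}p_j)^6}{5}\Bigr),$$ and such that, for all $(x,y)\in\mathcal{B}_n$, $$\mathbb{P}\bigl(\widetilde{LC_n}-LC_n=1\mid X_1\cdots X_n=x,\,Y_1\cdots Y_n=y\bigr)\ge\frac{K_0}{m},$$ $$\mathbb{P}\bigl(\widetilde{LC_n}-LC_n=-1\mid X_1\cdots X_n=x,\,Y_1\cdots Y_n=y\bigr)\le\frac{K}{2m}.$$ -/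

import Mathlib

open MeasureTheory ProbabilityTheory

namespace LCS

/-- `x` and `y` have a common subsequence of length `k`. -/
def HasCommonSubseq {A : Type*} {n : ℕ} (x y : Fin n → A) (k : ℕ) : Prop :=
  ∃ i j : Fin k → Fin n, StrictMono i ∧ StrictMono j ∧ ∀ s, x (i s) = y (j s)

/-- The length of the longest common subsequence of two words of length `n`
(the set is nonempty and bounded by `n`, so the supremum is a maximum). -/
noncomputable def lc {A : Type*} {n : ℕ} (x y : Fin n → A) : ℕ :=
  sSup {k | HasCommonSubseq x y k}

/-- The finite word made of the first `n` letters of a random sequence. -/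
def word {Ω A : Type*} (X : ℕ → Ω → A) (n : ℕ) (ω : Ω) : Fin n → A :=
  fun i => X i ω

/-- The event that the two words of length `n` are `x` and `y`. -/
def wordsEq {Ω A : Type*} {n : ℕ} (X Y : ℕ → Ω → A) (x y : Fin n → A) : Set Ω :=
  {ω | word X n ω = x ∧ word Y n ω = y}

/-- The positions in the pair `(x, y)` holding a letter other than `a`; `Sum.inl i` is the
position `i` of `x` and `Sum.inr i` is the position `i` of `y`. -/
def otherPositions {A : Type*} {n : ℕ} (a : A) (x y : Fin n → A) : Set (Fin n ⊕ Fin n) :=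
  {s | Sum.elim x y s ≠ a}

/-- The pair of words obtained from `(x, y)` by writing the letter `a` at the position `s`. -/
def changeAt {A : Type*} {n : ℕ} (a : A) (x y : Fin n → A) :
    Fin n ⊕ Fin n → (Fin n → A) × (Fin n → A)
  | Sum.inl i => (Function.update x i a, y)
  | Sum.inr i => (x, Function.update y i a)

/-- `J` picks, given the two words of length `n`, a position uniformly at random among those
holding a letter other than `a`. If there is no such position nothing is required of `J`:
all the letters are then equal to `a`, and `changeAt` leaves the words as they are. -/
def IsUniformPick {Ω A : Type*} [MeasurableSpace Ω] (μ : Measure Ω) {n : ℕ} (a : A)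
    (X Y : ℕ → Ω → A) (J : Ω → Fin n ⊕ Fin n) : Prop :=
  ∀ x y : Fin n → A, μ (wordsEq X Y x y) ≠ 0 → (otherPositions a x y).Nonempty →
    (μ[|wordsEq X Y x y]).map J = uniformOn (otherPositions a x y)

/-- `LC_n`, as a random variable. -/
noncomputable def LC {Ω A : Type*} (n : ℕ) (X Y : ℕ → Ω → A) (ω : Ω) : ℕ :=
  lc (word X n ω) (word Y n ω)

/-- The length of the longest common subsequence after the letter at the picked position `J`
has been changed into `a`. -/
noncomputable def changedLC {Ω A : Type*} {n : ℕ} (a : A) (X Y : ℕ → Ω → A)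
    (J : Ω → Fin n ⊕ Fin n) (ω : Ω) : ℕ :=
  let z := changeAt a (word X n ω) (word Y n ω) (J ω)
  lc z.1 z.2

/-- The constant `2⁻⁴ 10⁻² e⁻⁶⁷`. -/
noncomputable def K₀ : ℝ := 2⁻¹ ^ 4 * 10⁻¹ ^ 2 * Real.exp (-67)

/-- The constant `min (2⁻⁴ 10⁻² e⁻⁶⁷, 1 / (800 m))`. -/
noncomputable def K (m : ℕ) : ℝ := min K₀ (1 / (800 * m))

/-- `max_{j ≠ j₀} p_j` (equal to `0` if `j₀` is the only letter). -/
noncomputable def maxOther {m : ℕ} (p : Fin m → ℝ) (j₀ : Fin m) : ℝ :=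
  ⨆ j : {j : Fin m // j ≠ j₀}, p j

end LCS

/-!
Write `o` for the frequent letter `j₀`, call the other letters rare, and let `s` and `ρ` be the sums
of `p j` and of `p j ^ 2` over the rare letters `j`. A longest common subsequence is cut at its
matched rare letters into pairs of segments, in which as many letters `o` as possible are matched.
Writing `o` at a rare position can only destroy a match at one of the `k` matched pairs of rare
letters, and it creates one at each rare letter of a segment with fewer letters `o` than its
partner. So it suffices that typically `k` is `O(n ρ)` and that such segments contain a positive
fraction of the about `2 n s` rare letters. Both are first moment bounds over alignments.

For the first, an alignment with `k` matched rare pairs, `v` matched and `t` unmatched letters `o`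
gets the weight `16 ^ k * 2 ^ (-t) * (1 - 200 ρ) ^ v`. The mean total weight is at most `2`, whereas
an optimal alignment of typical words with `k ≥ 200 n ρ` would be exponentially heavy.

For the second, optimal alignments with `l` rare letters in the poorer segments get the weight
`(1 + ρ / 100) ^ v * (1 - 2⁻²⁰) ^ t * (1 - 2 ^ 30 * ρ / s) ^ l`, and the point is that their mean
total weight is still `O(1 / ρ)`, so that `l` can hardly be small. A run of pairs of segments with
equally many letters `o` is read in groups of two letters `o`. In an optimal alignment two groups
`(r o o, o r o)` always have a group with three matches in between: otherwise one would gain a match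
by aligning the letters `r` of both. Such an exclusion costs a probability of order `ρ`, which pays
for the factors `1 + ρ / 100`.
-/

namespace LCS

open List
open scoped ENNReal

/-! ### Common sublists and alignments -/

section CommonSublist

variable {A : Type*}

/-- The lists `x` and `y` have a common sublist of length at least `k`; this is monotone in `k`,
unlike asking for length exactly `k` of a given sublist. -/
def CommonSublist (x y : List A) (k : ℕ) : Prop :=
  ∃ l : List A, l <+ x ∧ l <+ y ∧ k ≤ l.length

theorem CommonSublist.mono {x y : List A} {k k' : ℕ} (h : CommonSublist x y k) (hk : k' ≤ k) :
    CommonSublist x y k' :=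
  let ⟨l, hx, hy, hl⟩ := h
  ⟨l, hx, hy, hk.trans hl⟩

theorem CommonSublist.symm {x y : List A} {k : ℕ} (h : CommonSublist x y k) :
    CommonSublist y x k :=
  let ⟨l, hx, hy, hl⟩ := h
  ⟨l, hy, hx, hl⟩

theorem CommonSublist.append {a b x y : List A} {k k' : ℕ} (h : CommonSublist a b k)
    (h' : CommonSublist x y k') : CommonSublist (a ++ x) (b ++ y) (k + k') := by
  obtain ⟨l, ha, hb, hl⟩ := h
  obtain ⟨l', hx, hy, hl'⟩ := h'
  exact ⟨l ++ l', ha.append hx, hb.append hy, by rw [length_append]; omega⟩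

theorem CommonSublist.singleton (r : A) : CommonSublist [r] [r] 1 :=
  ⟨[r], Sublist.refl _, Sublist.refl _, le_rfl⟩

theorem CommonSublist.cons {x y : List A} {k : ℕ} (r : A) (h : CommonSublist x y k) :
    CommonSublist (r :: x) (r :: y) (k + 1) := by
  obtain ⟨l, hx, hy, hl⟩ := h
  exact ⟨r :: l, hx.cons_cons r, hy.cons_cons r, by rw [length_cons]; omega⟩

theorem exists_sublist_of_sublist_set {l x : List A} {i : ℕ} {c : A} (h : l <+ x.set i c) :
    ∃ l', l' <+ x ∧ l' <+ l ∧ l.length ≤ l'.length + 1 := by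
  by_cases hi : i < x.length
  · rw [set_eq_take_append_cons_drop, if_pos hi, sublist_append_iff] at h
    obtain ⟨l₁, l₂, rfl, h₁, h₂⟩ := h
    refine ⟨l₁ ++ l₂.tail, ?_, (Sublist.refl _).append (tail_sublist _), by simp; omega⟩
    exact (eraseIdx_eq_take_drop_succ x i ▸ h₁.append h₂.tail).trans (eraseIdx_sublist x i)
  · rw [set_eq_of_length_le (not_lt.1 hi)] at h
    exact ⟨l, h, Sublist.refl _, Nat.le_succ _⟩

theorem CommonSublist.of_set {x y : List A} {k i : ℕ} {c : A}
    (h : CommonSublist (x.set i c) y (k + 1)) : CommonSublist x y k := by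
  obtain ⟨l, hx, hy, hl⟩ := h
  obtain ⟨l', hx', hl', hlen⟩ := exists_sublist_of_sublist_set hx
  exact ⟨l', hx', hl'.trans hy, by omega⟩

theorem exists_eq_append_cons_of_cons_sublist {c : A} {l x : List A} (h : c :: l <+ x) :
    ∃ x₁ x₂, x = x₁ ++ c :: x₂ ∧ l <+ x₂ := by
  obtain ⟨r₁, r₂, rfl, hc, hl⟩ := cons_sublist_iff.1 h
  obtain ⟨s, t, rfl⟩ := append_of_mem hc
  exact ⟨s, t ++ r₂, by simp, hl.trans (sublist_append_right t r₂)⟩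

/-- Every common sublist of `x` and `y` has length at most `v`. -/
def MaxCommon (x y : List A) (v : ℕ) : Prop := ∀ k, CommonSublist x y k → k ≤ v

theorem MaxCommon.of_append_left {a b x y : List A} {v w : ℕ}
    (h : MaxCommon (a ++ x) (b ++ y) (v + w)) (hw : CommonSublist x y w) : MaxCommon a b v :=
  fun k hk => Nat.le_of_add_le_add_right (h (k + w) (hk.append hw))

theorem MaxCommon.of_append_right {a b x y : List A} {v w : ℕ}
    (h : MaxCommon (a ++ x) (b ++ y) (v + w)) (hv : CommonSublist a b v) : MaxCommon x y w :=
  fun k hk => Nat.le_of_add_le_add_left (h (v + k) (hv.append hk))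

theorem MaxCommon.of_append_cons {a b x y : List A} {r : A} {v w : ℕ}
    (h : MaxCommon (a ++ r :: x) (b ++ r :: y) (v + (w + 1))) (hv : CommonSublist a b v) :
    MaxCommon x y w :=
  fun _ hk => Nat.le_of_succ_le_succ (h.of_append_right hv _ (hk.cons r))

variable [DecidableEq A] (o : A)

theorem commonSublist_of_le_count {x y : List A} {k : ℕ} (hx : k ≤ x.count o)
    (hy : k ≤ y.count o) : CommonSublist x y k :=
  ⟨replicate k o, replicate_sublist_iff.2 hx, replicate_sublist_iff.2 hy, by simp⟩

/-- The number of letters of `l` other than the frequent letter `o`; these letters are called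
rare. -/
def rares (l : List A) : ℕ := l.countP (· ≠ o)

theorem rares_cons (c : A) (l : List A) :
    rares o (c :: l) = rares o l + if c = o then 0 else 1 := by
  by_cases h : c = o <;> simp [rares, h]

theorem count_add_rares (l : List A) : l.count o + rares o l = l.length := by
  rw [length_eq_countP_add_countP (· == o), count, rares]
  simp

end CommonSublist

section ChangedLetter

variable {A : Type*} [DecidableEq A] (o : A)

open scoped Classical in
/-- The number of rare positions of `x` at which writing `o` creates a common sublist with `y` of
length more than `v`. -/
noncomputable def gainCount (x y : List A) (v : ℕ) : ℕ :=
  Nat.count (fun i => x.getD i o ≠ o ∧ CommonSublist (x.set i o) y (v + 1)) x.length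

open scoped Classical in
/-- The number of rare positions of `x` at which writing `o` destroys all common sublists with `y`
of length at least `v`. -/
noncomputable def lossCount (x y : List A) (v : ℕ) : ℕ :=
  Nat.count (fun i => x.getD i o ≠ o ∧ ¬ CommonSublist (x.set i o) y v) x.length

theorem gainCount_append_le {a b x y : List A} {v w : ℕ} (h : CommonSublist a b v)
    (h' : CommonSublist x y w) :
    gainCount o a b v + gainCount o x y w ≤ gainCount o (a ++ x) (b ++ y) (v + w) := by
  classical
  unfold gainCount
  rw [length_append, Nat.count_add]
  refine Nat.add_le_add (Nat.count_mono_left fun i hi hp => ?_)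
    (Nat.count_mono_left fun i _ hp => ?_)
  · rw [getD_append _ _ _ _ hi, set_append, if_pos hi]
    exact ⟨hp.1, (hp.2.append h').mono (by omega)⟩
  · rw [getD_append_right _ _ _ _ (by omega), set_append, if_neg (by omega),
      Nat.add_sub_cancel_left]
    exact ⟨hp.1, h.append hp.2⟩

theorem lossCount_append_le {a b x y : List A} {v w : ℕ} (h : CommonSublist a b v)
    (h' : CommonSublist x y w) :
    lossCount o (a ++ x) (b ++ y) (v + w) ≤ lossCount o a b v + lossCount o x y w := by
  classical
  unfold lossCount
  rw [length_append, Nat.count_add]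
  refine Nat.add_le_add (Nat.count_mono_left fun i hi hp => ?_)
    (Nat.count_mono_left fun i _ hp => ?_)
  · rw [getD_append _ _ _ _ hi, set_append, if_pos hi] at hp
    exact ⟨hp.1, fun hc => hp.2 (hc.append h')⟩
  · rw [getD_append_right _ _ _ _ (by omega), set_append, if_neg (by omega),
      Nat.add_sub_cancel_left] at hp
    exact ⟨hp.1, fun hc => hp.2 (h.append hc)⟩

theorem gainCount_append_cons_le {a b x y : List A} {v w : ℕ} (r : A) (h : CommonSublist a b v)
    (h' : CommonSublist x y w) :
    gainCount o a b v + gainCount o x y w ≤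
      gainCount o (a ++ r :: x) (b ++ r :: y) (v + (w + 1)) := by
  have hcons := gainCount_append_le o (CommonSublist.singleton r) h'
  have happend := gainCount_append_le o h (h'.cons r)
  rw [singleton_append, singleton_append, add_comm 1] at hcons
  omega

theorem lossCount_append_cons_le {a b x y : List A} {v w : ℕ} (r : A) (h : CommonSublist a b v)
    (h' : CommonSublist x y w) :
    lossCount o (a ++ r :: x) (b ++ r :: y) (v + (w + 1)) ≤
      lossCount o a b v + lossCount o x y w + 1 := by
  classical
  have hcons := lossCount_append_le o (CommonSublist.singleton r) h'
  have happend := lossCount_append_le o h (h'.cons r)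
  have hone : lossCount o [r] [r] 1 ≤ 1 := Nat.count_le _
  rw [singleton_append, singleton_append, add_comm 1] at hcons
  omega

theorem count_getD_ne (l : List A) :
    Nat.count (fun i => l.getD i o ≠ o) l.length = rares o l := by
  induction l with
  | nil => rfl
  | cons c l ih =>
    rw [length_cons, Nat.count_succ', rares_cons]
    simp only [getD_cons_succ, getD_cons_zero, ih]
    by_cases h : c = o <;> simp [h]

theorem count_set_of_getD_ne {l : List A} {i : ℕ} (hi : i < l.length) (h : l.getD i o ≠ o) :
    (l.set i o).count o = l.count o + 1 := by
  rw [getD_eq_getElem _ _ hi] at h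
  simp [count_set hi, h]

theorem lossCount_eq_zero {a b : List A} {v : ℕ} (ha : v ≤ a.count o) (hb : v ≤ b.count o) :
    lossCount o a b v = 0 := by
  classical
  refine Nat.eq_zero_of_le_zero <|
    (Nat.count_mono_left (q := fun _ => False) fun i hi hp => hp.2 ?_).trans (by simp)
  exact commonSublist_of_le_count o (by rw [count_set_of_getD_ne o hi hp.1]; omega) hb

theorem rares_le_gainCount {a b : List A} {v : ℕ} (ha : v ≤ a.count o) (hb : v < b.count o) :
    rares o a ≤ gainCount o a b v := by
  classical
  rw [← count_getD_ne]
  refine Nat.count_mono_left fun i hi hp => ⟨hp, ?_⟩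
  exact commonSublist_of_le_count o (by rw [count_set_of_getD_ne o hi hp]; omega) hb

end ChangedLetter

section Alignments

variable {A : Type*} [DecidableEq A] (o : A)

/-- The number of letters `o` left over when as many letters `o` as possible of `a` and `b` are
matched with each other. -/
def gap (a b : List A) : ℕ := Nat.dist (a.count o) (b.count o)

/-- The number of rare letters in whichever of the two lists has strictly fewer letters `o`. -/
def raresOfPoorer (a b : List A) : ℕ :=
  if a.count o < b.count o then rares o a else if b.count o < a.count o then rares o b else 0

theorem raresOfPoorer_le_gainCount (a b : List A) :
    raresOfPoorer o a b ≤ gainCount o a b (min (a.count o) (b.count o)) +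
      gainCount o b a (min (a.count o) (b.count o)) := by
  unfold raresOfPoorer
  split_ifs with hab hba
  · exact (rares_le_gainCount o (min_le_left _ _) (by omega)).trans (Nat.le_add_right _ _)
  · exact (rares_le_gainCount o (min_le_right _ _) (by omega)).trans (Nat.le_add_left _ _)
  · exact Nat.zero_le _

/-- An alignment of two words: matched pairs of equal rare letters cut the words into pairs of
segments, and in each pair of segments as many letters `o` as possible are matched. -/
inductive Alignment : List A → List A → Type _
  | last (a b : List A) : Alignment a b
  | cons (a b : List A) (r : A) (hr : r ≠ o) {x y : List A} (α : Alignment x y) :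
      Alignment (a ++ r :: x) (b ++ r :: y)

namespace Alignment

variable {o} {x y : List A}

/-- The number of matched pairs of rare letters. -/
def rareMatches : ∀ {x y : List A}, Alignment o x y → ℕ
  | _, _, last _ _ => 0
  | _, _, cons _ _ _ _ α => α.rareMatches + 1

/-- The number of matched pairs of letters `o`. -/
def commonMatches : ∀ {x y : List A}, Alignment o x y → ℕ
  | _, _, last a b => min (a.count o) (b.count o)
  | _, _, cons a b _ _ α => min (a.count o) (b.count o) + α.commonMatches

/-- The number of letters `o` that are not matched. -/
def unmatched : ∀ {x y : List A}, Alignment o x y → ℕ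
  | _, _, last a b => gap o a b
  | _, _, cons a b _ _ α => gap o a b + α.unmatched

/-- The number of rare letters in the segments with fewer letters `o` than their partner. -/
def poorRares : ∀ {x y : List A}, Alignment o x y → ℕ
  | _, _, last a b => raresOfPoorer o a b
  | _, _, cons a b _ _ α => raresOfPoorer o a b + α.poorRares

/-- The number of matched pairs of letters. -/
def size (α : Alignment o x y) : ℕ := α.rareMatches + α.commonMatches

/-- An alignment whose size is the length of the longest common subsequence. -/
def IsOptimal (α : Alignment o x y) : Prop := MaxCommon x y α.size

theorem size_cons (a b : List A) (r : A) (hr : r ≠ o) (α : Alignment o x y) :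
    (cons a b r hr α).size = min (a.count o) (b.count o) + (α.size + 1) := by
  simp only [size, rareMatches, commonMatches]; omega

theorem size_last (a b : List A) :
    (last a b : Alignment o a b).size = min (a.count o) (b.count o) := zero_add _

theorem commonSublist (α : Alignment o x y) : CommonSublist x y α.size := by
  induction α with
  | last a b =>
    exact size_last (o := o) a b ▸
      commonSublist_of_le_count o (min_le_left _ _) (min_le_right _ _)
  | cons a b r hr α ih =>
    rw [size_cons]
    exact (commonSublist_of_le_count o (min_le_left _ _) (min_le_right _ _)).append (ih.cons r)

theorem count_add_count (α : Alignment o x y) :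
    x.count o + y.count o = 2 * α.commonMatches + α.unmatched := by
  induction α with
  | last a b => simp only [commonMatches, unmatched, gap, Nat.dist]; omega
  | cons a b r hr α ih =>
    simp only [count_append, count_cons, gap, beq_iff_eq, if_neg hr, commonMatches, unmatched,
      Nat.dist]
    omega

theorem lossCount_le (α : Alignment o x y) :
    lossCount o x y α.size ≤ α.rareMatches ∧ lossCount o y x α.size ≤ α.rareMatches := by
  induction α with
  | last a b =>
    rw [size_last, lossCount_eq_zero o (min_le_left _ _) (min_le_right _ _),
      lossCount_eq_zero o (min_le_right _ _) (min_le_left _ _)]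
    exact ⟨Nat.zero_le _, Nat.zero_le _⟩
  | cons a b r hr α ih =>
    have hab := commonSublist_of_le_count o (min_le_left (a.count o) (b.count o))
      (min_le_right _ _)
    have hxy := lossCount_append_cons_le o r hab α.commonSublist
    have hyx := lossCount_append_cons_le o r hab.symm α.commonSublist.symm
    rw [lossCount_eq_zero o (min_le_left _ _) (min_le_right _ _)] at hxy
    rw [lossCount_eq_zero o (min_le_right _ _) (min_le_left _ _)] at hyx
    rw [size_cons, rareMatches]
    omega

theorem poorRares_le_gainCount (α : Alignment o x y) :
    α.poorRares ≤ gainCount o x y α.size + gainCount o y x α.size := by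
  induction α with
  | last a b => rw [size_last]; exact raresOfPoorer_le_gainCount o a b
  | cons a b r hr α ih =>
    have hab := commonSublist_of_le_count o (min_le_left (a.count o) (b.count o))
      (min_le_right _ _)
    have hxy := gainCount_append_cons_le o r hab α.commonSublist
    have hyx := gainCount_append_cons_le o r hab.symm α.commonSublist.symm
    have hpoor := raresOfPoorer_le_gainCount o a b
    rw [size_cons, poorRares]
    omega

theorem exists_size_succ_le (α : Alignment o x y) (a b : List A) :
    ∃ β : Alignment o (a ++ o :: x) (b ++ o :: y), α.size + 1 ≤ β.size := by
  cases α with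
  | last x y =>
    refine ⟨last _ _, ?_⟩
    simp only [size_last, count_append, count_cons_self]
    omega
  | @cons c d r hr x y α =>
    suffices ∃ β : Alignment o ((a ++ o :: c) ++ r :: x) ((b ++ o :: d) ++ r :: y),
      (cons c d r hr α).size + 1 ≤ β.size by rwa [append_assoc, append_assoc] at this
    refine ⟨cons _ _ r hr α, ?_⟩
    simp only [size_cons, count_append, count_cons_self]
    omega

variable (o) in
theorem exists_length_le_size {l : List A} (hx : l <+ x) (hy : l <+ y) :
    ∃ α : Alignment o x y, l.length ≤ α.size := by
  induction l generalizing x y with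
  | nil => exact ⟨last x y, Nat.zero_le _⟩
  | cons c l ih =>
    obtain ⟨x₁, x₂, rfl, hx'⟩ := exists_eq_append_cons_of_cons_sublist hx
    obtain ⟨y₁, y₂, rfl, hy'⟩ := exists_eq_append_cons_of_cons_sublist hy
    obtain ⟨α, hα⟩ := ih hx' hy'
    by_cases hc : c = o
    · subst hc
      obtain ⟨β, hβ⟩ := α.exists_size_succ_le x₁ y₁
      exact ⟨β, by rw [length_cons]; omega⟩
    · exact ⟨cons x₁ y₁ c hc α, by rw [length_cons, size_cons]; omega⟩

variable (o) in
theorem exists_isOptimal {v : ℕ} (h : CommonSublist x y v) (hv : MaxCommon x y v) :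
    ∃ α : Alignment o x y, α.size = v ∧ α.IsOptimal := by
  obtain ⟨l, hx, hy, hl⟩ := h
  obtain ⟨α, hα⟩ := exists_length_le_size o hx hy
  have hsize : α.size = v := le_antisymm (hv _ α.commonSublist) (hl.trans hα)
  exact ⟨α, hsize, by rwa [IsOptimal, hsize]⟩

end Alignment

end Alignments

/-! ### Weighted pairs of lists and automata -/

section ListSums

theorem tsum_ite_exists_le {α ι : Type*} (f : ι → α) (p : ι → Prop) [DecidablePred p]
    (q : α → Prop) [DecidablePred q] (hq : ∀ x, q x → ∃ i, x = f i ∧ p i) (w : α → ℝ≥0∞) :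
    ∑' x, (if q x then w x else 0) ≤ ∑' i, if p i then w (f i) else 0 := by
  classical
  calc ∑' x, (if q x then w x else 0)
      ≤ ∑' x, ∑' i, (if x = f i then (if p i then w (f i) else 0) else 0) := by
        refine ENNReal.tsum_le_tsum fun x => ?_
        split_ifs with h
        · obtain ⟨i, rfl, hi⟩ := hq x h
          exact le_trans (by simp [hi]) (ENNReal.le_tsum i)
        · exact zero_le
    _ = ∑' i, if p i then w (f i) else 0 := by
        rw [ENNReal.tsum_comm]
        exact tsum_congr fun i => tsum_ite_eq _ _

theorem tsum_tsum_le_add (F : ℕ → ℕ → ℝ≥0∞) :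
    ∑' i, ∑' j, F i j ≤ ∑' i, ∑' d, F i (i + d) + ∑' i, ∑' d, F (i + d) i := by
  have hle (G : ℕ → ℕ → ℝ≥0∞) :
      ∑' i, ∑' j, (if i ≤ j then G i j else 0) ≤ ∑' i, ∑' d, G i (i + d) := by
    refine ENNReal.tsum_le_tsum fun i => ?_
    simpa using tsum_ite_exists_le (fun d => i + d) (fun _ => True) (fun j => i ≤ j)
      (fun j hj => ⟨j - i, (Nat.add_sub_of_le hj).symm, trivial⟩) (G i)
  calc ∑' i, ∑' j, F i j
      ≤ ∑' i, ∑' j, ((if i ≤ j then F i j else 0) + (if j ≤ i then F i j else 0)) := by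
        refine ENNReal.tsum_le_tsum fun i => ENNReal.tsum_le_tsum fun j => ?_
        by_cases h : i ≤ j
        · simp [h]
        · simp [(not_le.1 h).le]
    _ = ∑' i, ∑' j, (if i ≤ j then F i j else 0) +
          ∑' j, ∑' i, (if j ≤ i then F i j else 0) := by
        simp only [ENNReal.tsum_add]
        rw [ENNReal.tsum_comm (f := fun i j => if j ≤ i then F i j else 0)]
    _ ≤ _ := add_le_add (hle F) (hle fun j i => F i j)

theorem exists_eq_append_cons_of_count_eq_succ {A : Type*} [DecidableEq A] (o : A)
    {l : List A} {k : ℕ} (h : l.count o = k + 1) :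
    ∃ a b, l = a ++ o :: b ∧ a.count o = 0 ∧ b.count o = k := by
  have hmem : o ∈ l := count_pos_iff.1 (by omega)
  obtain ⟨a, b, rfl, ha⟩ := eq_append_cons_of_mem hmem
  rw [count_append, count_cons_self, count_eq_zero.2 ha] at h
  exact ⟨a, b, rfl, count_eq_zero.2 ha, by omega⟩

variable {A : Type*} (c d : A → ℝ≥0∞)

/-- The weight of a list: the product of the weights of its letters. -/
noncomputable def wt (l : List A) : ℝ≥0∞ := (l.map c).prod

@[simp] theorem wt_nil : wt c [] = 1 := rfl

theorem wt_cons (a : A) (l : List A) : wt c (a :: l) = c a * wt c l := by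
  rw [wt, map_cons, prod_cons, wt]

theorem wt_append (l l' : List A) : wt c (l ++ l') = wt c l * wt c l' := by
  rw [wt, map_append, prod_append, wt, wt]

variable [Fintype A]

theorem tsum_list (h : List A → ℝ≥0∞) :
    ∑' l, h l = h [] + ∑ c, ∑' l, h (c :: l) := by
  classical
  have hinj : Function.Injective (fun q : A × List A => q.1 :: q.2) :=
    fun q q' hq => Prod.ext (cons.inj hq).1 (cons.inj hq).2
  have hcons := hinj.tsum_eq (f := fun l => if l = [] then 0 else h l) fun l hl => by
    cases l with
    | nil => simp at hl
    | cons a l => exact ⟨(a, l), rfl⟩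
  rw [ENNReal.tsum_eq_add_tsum_ite []]
  congr 1
  refine Eq.trans (tsum_congr fun l => ?_) (hcons.symm.trans ?_)
  · by_cases hl : l = [] <;> simp [hl]
  · rw [ENNReal.tsum_prod', tsum_fintype]
    simp

theorem tsum_wt_length (n : ℕ) :
    ∑' l, (if l.length = n then wt c l else 0) = (∑ a, c a) ^ n := by
  induction n with
  | zero => simp
  | succ n ih =>
    rw [tsum_list]
    simp only [length_nil, length_cons, Nat.add_right_cancel_iff, wt_cons]
    rw [if_neg (by omega), zero_add, pow_succ', Finset.sum_mul, ← ih]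
    refine Finset.sum_congr rfl fun a _ => ?_
    simp only [← ENNReal.tsum_mul_left, mul_ite, mul_zero]

theorem tsum_wt : ∑' l, wt c l = (1 - ∑ a, c a)⁻¹ := by
  calc ∑' l, wt c l = ∑' (l : List A) (n : ℕ), if l.length = n then wt c l else 0 :=
        tsum_congr fun l => by rw [tsum_eq_single l.length (by simp_all [eq_comm])]; simp
    _ = (1 - ∑ a, c a)⁻¹ := by
        rw [ENNReal.tsum_comm, ← ENNReal.tsum_geometric]
        exact tsum_congr (tsum_wt_length c)

variable [DecidableEq A] (o : A)

/-- The total weight of the rare letters. -/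
noncomputable def rareMass : ℝ≥0∞ := ∑ a ∈ Finset.univ.erase o, c a

theorem tsum_wt_count_zero :
    ∑' l, (if l.count o = 0 then wt c l else 0) = (1 - rareMass c o)⁻¹ := by
  have hsum : ∑ a, Function.update c o 0 a = rareMass c o := by
    rw [Finset.sum_update_of_mem (Finset.mem_univ o), zero_add, Finset.sdiff_singleton_eq_erase,
      rareMass]
  rw [← hsum, ← tsum_wt]
  refine tsum_congr fun l => ?_
  induction l with
  | nil => simp
  | cons a l ih =>
    by_cases ha : a = o
    · simp [ha, wt_cons]
    · rw [wt_cons, wt_cons, Function.update_of_ne ha, ← ih, count_cons_of_ne (by simpa using ha),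
        mul_ite, mul_zero]

theorem tsum_wt_count_le (k : ℕ) :
    ∑' l, (if l.count o = k then wt c l else 0) ≤
      c o ^ k * (1 - rareMass c o)⁻¹ ^ (k + 1) := by
  induction k with
  | zero => simp [tsum_wt_count_zero]
  | succ k ih =>
    calc ∑' l, (if l.count o = k + 1 then wt c l else 0)
        ≤ ∑' q : List A × List A, if q.1.count o = 0 ∧ q.2.count o = k then
            wt c (q.1 ++ o :: q.2) else 0 :=
          tsum_ite_exists_le (fun q : List A × List A => q.1 ++ o :: q.2) _ _
            (fun l hl => by
              obtain ⟨a, b, rfl, ha, hb⟩ := exists_eq_append_cons_of_count_eq_succ o hl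
              exact ⟨(a, b), rfl, ha, hb⟩) _
      _ = (∑' l, if l.count o = 0 then wt c l else 0) * c o *
            ∑' l, if l.count o = k then wt c l else 0 := by
          rw [ENNReal.tsum_prod', mul_assoc, ← ENNReal.tsum_mul_right]
          refine tsum_congr fun a => ?_
          simp only [← ENNReal.tsum_mul_left, wt_append, wt_cons, ite_mul, mul_ite, zero_mul,
            mul_zero, ite_and]
          split_ifs <;> simp
      _ ≤ (1 - rareMass c o)⁻¹ * c o * (c o ^ k * (1 - rareMass c o)⁻¹ ^ (k + 1)) := by
          rw [tsum_wt_count_zero]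
          gcongr
      _ = _ := by ring

theorem tsum_wt_mul_count_le (f : ℕ → ℝ≥0∞) :
    ∑' l, wt c l * f (l.count o) ≤ ∑' k, c o ^ k * (1 - rareMass c o)⁻¹ ^ (k + 1) * f k := by
  calc ∑' l, wt c l * f (l.count o)
      = ∑' l : List A, ∑' k, (if l.count o = k then wt c l else 0) * f k :=
        tsum_congr fun l => by
          rw [tsum_eq_single (l.count o) (by simp_all [eq_comm])]; simp
    _ = ∑' k, (∑' l : List A, (if l.count o = k then wt c l else 0)) * f k := by
        rw [ENNReal.tsum_comm]
        exact tsum_congr fun k => ENNReal.tsum_mul_right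
    _ ≤ _ := ENNReal.tsum_le_tsum fun k => mul_le_mul_left (tsum_wt_count_le c o k) _

theorem tsum_wt_mul_wt_mul_count_le (F : ℕ → ℕ → ℝ≥0∞) :
    ∑' x : List A × List A, wt c x.1 * wt d x.2 * F (x.1.count o) (x.2.count o) ≤
      ∑' i, ∑' j, (c o ^ i * (1 - rareMass c o)⁻¹ ^ (i + 1)) *
        (d o ^ j * (1 - rareMass d o)⁻¹ ^ (j + 1)) * F i j := by
  calc ∑' x : List A × List A, wt c x.1 * wt d x.2 * F (x.1.count o) (x.2.count o)
      = ∑' a, wt c a * ∑' b, wt d b * F (a.count o) (b.count o) := by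
        simp only [ENNReal.tsum_prod', mul_assoc, ENNReal.tsum_mul_left]
    _ ≤ ∑' a, wt c a * ∑' j, d o ^ j * (1 - rareMass d o)⁻¹ ^ (j + 1) * F (a.count o) j := by
        gcongr with a
        exact tsum_wt_mul_count_le d o (F (a.count o))
    _ ≤ ∑' i, c o ^ i * (1 - rareMass c o)⁻¹ ^ (i + 1) *
          ∑' j, d o ^ j * (1 - rareMass d o)⁻¹ ^ (j + 1) * F i j :=
        tsum_wt_mul_count_le c o fun i => ∑' j, d o ^ j * (1 - rareMass d o)⁻¹ ^ (j + 1) * F i j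
    _ = _ := by simp only [mul_assoc, ENNReal.tsum_mul_left]

end ListSums

section PairSums

variable {A : Type*}

/-- The weight of a pair of lists. -/
noncomputable def wt₂ (c : A → ℝ≥0∞) (x : List A × List A) : ℝ≥0∞ := wt c x.1 * wt c x.2

theorem wt₂_append (c : A → ℝ≥0∞) (a x : List A × List A) :
    wt₂ c (a.1 ++ x.1, a.2 ++ x.2) = wt₂ c a * wt₂ c x := by
  simp only [wt₂, wt_append]
  ring

/-- The total weight of the pairs of lists of lengths `n` and `n'`, multiplied by `f`. -/
noncomputable def lenSum (c : A → ℝ≥0∞) (n n' : ℕ) (f : List A × List A → ℝ≥0∞) : ℝ≥0∞ :=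
  ∑' x : List A × List A, if x.1.length = n ∧ x.2.length = n' then wt₂ c x * f x else 0

theorem lenSum_add (c : A → ℝ≥0∞) (n n' : ℕ) (f g : List A × List A → ℝ≥0∞) :
    lenSum c n n' (fun x => f x + g x) = lenSum c n n' f + lenSum c n n' g := by
  simp only [lenSum, ← ENNReal.tsum_add]
  refine tsum_congr fun x => ?_
  split_ifs
  · ring
  · simp

theorem lenSum_const_mul (c : A → ℝ≥0∞) (n n' : ℕ) (r : ℝ≥0∞) (f : List A × List A → ℝ≥0∞) :
    lenSum c n n' (fun x => r * f x) = r * lenSum c n n' f := by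
  simp only [lenSum, ← ENNReal.tsum_mul_left]
  refine tsum_congr fun x => ?_
  split_ifs
  · ring
  · simp

theorem lenSum_sum {S : Type*} [Fintype S] (c : A → ℝ≥0∞) (n n' : ℕ)
    (f : S → List A × List A → ℝ≥0∞) :
    lenSum c n n' (fun x => ∑ s, f s x) = ∑ s, lenSum c n n' (f s) := by
  simp only [lenSum]
  rw [← Summable.tsum_finsetSum fun _ _ => ENNReal.summable]
  refine tsum_congr fun x => ?_
  split_ifs
  · rw [Finset.mul_sum]
  · simp

theorem lenSum_one [Fintype A] {c : A → ℝ≥0∞} (hc : ∑ a, c a = 1) (n n' : ℕ) :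
    lenSum c n n' (fun _ => 1) = 1 := by
  have hlen := tsum_wt_length c
  simp only [hc, one_pow] at hlen
  calc lenSum c n n' (fun _ => 1)
      = (∑' l : List A, if l.length = n then wt c l else 0) *
          ∑' l : List A, if l.length = n' then wt c l else 0 := by
        rw [lenSum, ENNReal.tsum_prod', ← ENNReal.tsum_mul_right]
        refine tsum_congr fun a => ?_
        rw [← ENNReal.tsum_mul_left]
        refine tsum_congr fun b => ?_
        by_cases ha : a.length = n <;> by_cases hb : b.length = n' <;> simp [wt₂, ha, hb]
    _ = 1 := by rw [hlen, hlen, one_mul]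

open scoped Classical in
/-- The convolution of `f` and `g` for the componentwise concatenation of pairs of lists. -/
noncomputable def conv (f g : List A × List A → ℝ≥0∞) (x : List A × List A) : ℝ≥0∞ :=
  ∑' a : List A × List A, ∑' y : List A × List A,
    if x = (a.1 ++ y.1, a.2 ++ y.2) then f a * g y else 0

theorem mul_le_conv (f g : List A × List A → ℝ≥0∞) (a b x y : List A) :
    f (a, b) * g (x, y) ≤ conv f g (a ++ x, b ++ y) := by
  classical
  refine le_trans ?_ (ENNReal.le_tsum (a, b))
  refine le_trans ?_ (ENNReal.le_tsum (x, y))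
  rw [if_pos rfl]

theorem conv_mono {f f' g g' : List A × List A → ℝ≥0∞} (hf : ∀ x, f x ≤ f' x)
    (hg : ∀ x, g x ≤ g' x) (x : List A × List A) : conv f g x ≤ conv f' g' x := by
  unfold conv
  gcongr with a y
  split_ifs
  · exact mul_le_mul' (hf a) (hg y)
  · rfl

theorem tsum_mul_conv (w f g : List A × List A → ℝ≥0∞) :
    ∑' x, w x * conv f g x = ∑' a : List A × List A, ∑' y : List A × List A,
      w (a.1 ++ y.1, a.2 ++ y.2) * (f a * g y) := by
  classical
  simp only [conv, ← ENNReal.tsum_mul_left, mul_ite, mul_zero]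
  rw [ENNReal.tsum_comm]
  refine tsum_congr fun a => ?_
  rw [ENNReal.tsum_comm]
  exact tsum_congr fun y => tsum_ite_eq _ _

theorem tsum_wt₂_mul_conv (c : A → ℝ≥0∞) (f g : List A × List A → ℝ≥0∞) :
    ∑' x, wt₂ c x * conv f g x = (∑' x, wt₂ c x * f x) * ∑' x, wt₂ c x * g x := by
  rw [tsum_mul_conv, ← ENNReal.tsum_mul_right]
  refine tsum_congr fun a => ?_
  rw [← ENNReal.tsum_mul_left]
  refine tsum_congr fun y => ?_
  rw [wt₂_append]
  ring

theorem lenSum_conv_le (c : A → ℝ≥0∞) (f : List A × List A → ℝ≥0∞)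
    {g : List A × List A → ℝ≥0∞} {C : ℝ≥0∞} (hg : ∀ n n', lenSum c n n' g ≤ C) (n n' : ℕ) :
    lenSum c n n' (conv f g) ≤ (∑' x, wt₂ c x * f x) * C := by
  have hlen : lenSum c n n' (conv f g) =
      ∑' x : List A × List A,
        (if x.1.length = n ∧ x.2.length = n' then wt₂ c x else 0) * conv f g x :=
    tsum_congr fun x => by rw [ite_mul, zero_mul]
  rw [hlen, tsum_mul_conv, ← ENNReal.tsum_mul_right]
  refine ENNReal.tsum_le_tsum fun a => ?_
  refine le_trans ?_ (mul_le_mul_right (hg (n - a.1.length) (n' - a.2.length)) _)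
  rw [lenSum, ← ENNReal.tsum_mul_left]
  refine ENNReal.tsum_le_tsum fun y => ?_
  rw [wt₂_append, length_append, length_append]
  split_ifs
  · exact (by ring : _ = _).le
  · omega
  · simp
  · simp

end PairSums

section Automata

/-- A weighted automaton that reads a pair of lists piece by piece: `step s s' a` is the weight of
reading the pair `a` while moving from the state `s` to `s'`, and `final s a` that of reading `a`
as the last pair in the state `s`. -/
structure PairAutomaton (A S : Type*) where
  step : S → S → List A × List A → ℝ≥0∞
  final : S → List A × List A → ℝ≥0∞

namespace PairAutomaton

variable {A S : Type*} [Fintype S] {M : PairAutomaton A S}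

/-- The total weight of the ways to read a pair of lists, from the state `s`, in at most `N`
pieces. -/
noncomputable def totalWeight (M : PairAutomaton A S) : ℕ → S → List A × List A → ℝ≥0∞
  | 0, _, _ => 0
  | N + 1, s, x => M.final s x + ∑ s', conv (M.step s s') (M.totalWeight N s') x

theorem totalWeight_mono {N N' : ℕ} (h : N ≤ N') (s : S) (x : List A × List A) :
    M.totalWeight N s x ≤ M.totalWeight N' s x := by
  induction N generalizing N' s x with
  | zero => exact zero_le
  | succ N ih =>
    obtain ⟨N', rfl⟩ := Nat.exists_eq_add_of_le' (N.succ_pos.trans_le h)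
    exact add_le_add_right
      (Finset.sum_le_sum fun s' _ => conv_mono (fun _ => le_rfl)
        (ih (Nat.le_of_succ_le_succ h) s') x) _

variable (M) in
/-- From the state `s`, the total weight of the ways to read `(x, y)` is at least `t`. -/
def Reaches (s : S) (x y : List A) (t : ℝ≥0∞) : Prop := ∃ N, t ≤ M.totalWeight N s (x, y)

theorem Reaches.of_final {s : S} {x y : List A} {t : ℝ≥0∞} (h : t ≤ M.final s (x, y)) :
    M.Reaches s x y t :=
  ⟨1, h.trans le_self_add⟩

theorem Reaches.step {s s' : S} {a b x y : List A} {t w : ℝ≥0∞} (h : M.Reaches s' x y t)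
    (hw : w ≤ M.step s s' (a, b)) : M.Reaches s (a ++ x) (b ++ y) (w * t) := by
  obtain ⟨N, h⟩ := h
  refine ⟨N + 1, ?_⟩
  calc w * t ≤ M.step s s' (a, b) * M.totalWeight N s' (x, y) := mul_le_mul' hw h
    _ ≤ conv (M.step s s') (M.totalWeight N s') (a ++ x, b ++ y) := mul_le_conv _ _ _ _ _ _
    _ ≤ ∑ s', conv (M.step s s') (M.totalWeight N s') (a ++ x, b ++ y) :=
        Finset.single_le_sum (f := fun s' => conv (M.step s s') (M.totalWeight N s') _)
          (fun _ _ => zero_le) (Finset.mem_univ s')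
    _ ≤ M.totalWeight (N + 1) s (a ++ x, b ++ y) := le_add_self

theorem Reaches.of_state_le {s s' : S} {x y : List A} {t : ℝ≥0∞} (h : M.Reaches s x y t)
    (hfinal : ∀ x, M.final s x ≤ M.final s' x) (hstep : ∀ r x, M.step s r x ≤ M.step s' r x) :
    M.Reaches s' x y t := by
  obtain ⟨N, h⟩ := h
  refine ⟨N, h.trans ?_⟩
  cases N with
  | zero => exact zero_le
  | succ N =>
    exact add_le_add (hfinal _)
      (Finset.sum_le_sum fun r _ => conv_mono (hstep r) (fun _ => le_rfl) _)

theorem lenSum_totalWeight_le (c : A → ℝ≥0∞) {C φ : S → ℝ≥0∞}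
    (hC : ∀ s n n', lenSum c n n' (M.final s) ≤ C s)
    (hφ : ∀ s, C s + ∑ s', (∑' a, wt₂ c a * M.step s s' a) * φ s' ≤ φ s)
    (N : ℕ) (s : S) (n n' : ℕ) : lenSum c n n' (M.totalWeight N s) ≤ φ s := by
  induction N generalizing s n n' with
  | zero => simp [lenSum, totalWeight]
  | succ N ih =>
    calc lenSum c n n' (M.totalWeight (N + 1) s)
        = lenSum c n n' (M.final s) +
            ∑ s', lenSum c n n' (conv (M.step s s') (M.totalWeight N s')) := by
          rw [← lenSum_sum, ← lenSum_add]
          rfl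
      _ ≤ C s + ∑ s', (∑' a, wt₂ c a * M.step s s' a) * φ s' := by
          gcongr with s'
          · exact hC s n n'
          · exact lenSum_conv_le c _ (ih s') n n'
      _ ≤ φ s := hφ s

-- Markov inequality: the potential `φ` bounds the mean of the total weight.
theorem mul_sum_wt₂_le_of_reaches (c : A → ℝ≥0∞) {C φ : S → ℝ≥0∞}
    (hC : ∀ s n n', lenSum c n n' (M.final s) ≤ C s)
    (hφ : ∀ s, C s + ∑ s', (∑' a, wt₂ c a * M.step s s' a) * φ s' ≤ φ s)
    (s : S) (n : ℕ) (t : ℝ≥0∞) (B : Finset ((Fin n → A) × (Fin n → A)))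
    (hB : ∀ x ∈ B, M.Reaches s (List.ofFn x.1) (List.ofFn x.2) t) :
    t * ∑ x ∈ B, wt₂ c (List.ofFn x.1, List.ofFn x.2) ≤ φ s := by
  choose! N hN using hB
  have hinj : Function.Injective
      (fun x : (Fin n → A) × (Fin n → A) => (List.ofFn x.1, List.ofFn x.2)) := fun x y h =>
    Prod.ext (List.ofFn_injective (Prod.mk.inj h).1) (List.ofFn_injective (Prod.mk.inj h).2)
  refine le_trans ?_ (lenSum_totalWeight_le c hC hφ (B.sup N) s n n)
  refine le_trans ?_ (ENNReal.tsum_comp_le_tsum_of_injective hinj _)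
  refine le_trans ?_ (ENNReal.sum_le_tsum B)
  rw [Finset.mul_sum]
  refine Finset.sum_le_sum fun x hx => ?_
  rw [if_pos ⟨List.length_ofFn, List.length_ofFn⟩, mul_comm]
  exact mul_le_mul_right ((hN x hx).trans (totalWeight_mono (Finset.le_sup hx) _ _)) _

end PairAutomaton

end Automata

/-! ### Matched pairs of rare letters -/

section Laws

variable {A : Type*} [Fintype A] {o : A} {P : A → ℝ≥0∞}

variable (o P) in
/-- Weights of letters that form a probability distribution in which `o` has positive mass. -/
structure IsLaw : Prop where
  sum_eq_one : ∑ a, P a = 1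
  ne_zero : P o ≠ 0

theorem IsLaw.ne_top (hP : IsLaw o P) : P o ≠ ⊤ :=
  ne_top_of_le_ne_top ENNReal.one_ne_top
    (hP.sum_eq_one ▸ Finset.single_le_sum (fun _ _ => zero_le) (Finset.mem_univ o))

theorem IsLaw.pow_mul_inv_pow_succ (hP : IsLaw o P) (k : ℕ) :
    P o ^ k * (P o)⁻¹ ^ (k + 1) = (P o)⁻¹ := by
  rw [pow_succ, ← mul_assoc, ← mul_pow, ENNReal.mul_inv_cancel hP.ne_zero hP.ne_top, one_pow,
    one_mul]

theorem IsLaw.lenSum_le (hP : IsLaw o P) {f : List A × List A → ℝ≥0∞} {C : ℝ≥0∞}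
    (hf : ∀ x, f x ≤ C) (n n' : ℕ) : lenSum P n n' f ≤ C := by
  calc lenSum P n n' f ≤ C * lenSum P n n' fun _ => 1 := by
        unfold lenSum
        rw [← ENNReal.tsum_mul_left]
        gcongr with x
        split_ifs
        · rw [mul_one, mul_comm]
          exact mul_le_mul_left (hf x) _
        · exact zero_le
    _ = C := by rw [lenSum_one hP.sum_eq_one, mul_one]

variable [DecidableEq A]

theorem IsLaw.rareMass_add (hP : IsLaw o P) : rareMass P o + P o = 1 := by
  rw [rareMass, Finset.sum_erase_add _ _ (Finset.mem_univ o), hP.sum_eq_one]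

theorem IsLaw.one_sub_rareMass (hP : IsLaw o P) : 1 - rareMass P o = P o := by
  rw [← hP.rareMass_add]
  exact ENNReal.add_sub_cancel_left
    (ne_top_of_le_ne_top ENNReal.one_ne_top (hP.rareMass_add ▸ le_self_add))

theorem IsLaw.tsum_wt₂_mul_count_le (hP : IsLaw o P) (F : ℕ → ℕ → ℝ≥0∞) :
    ∑' x : List A × List A, wt₂ P x * F (x.1.count o) (x.2.count o) ≤
      (P o)⁻¹ ^ 2 * ∑' i, ∑' j, F i j := by
  refine (tsum_wt_mul_wt_mul_count_le P P o F).trans_eq ?_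
  simp only [hP.one_sub_rareMass, hP.pow_mul_inv_pow_succ, ENNReal.tsum_mul_left, sq]

variable (o) in
/-- The indicator of the pairs of lists formed by one and the same rare letter. -/
noncomputable def rarePair (x : List A × List A) : ℝ≥0∞ :=
  ∑ r ∈ Finset.univ.erase o, if x = ([r], [r]) then 1 else 0

variable (o P) in
/-- The probability that two letters are equal and rare. -/
noncomputable def coincidence : ℝ≥0∞ := ∑ r ∈ Finset.univ.erase o, P r ^ 2

theorem tsum_wt₂_mul_rarePair : ∑' x, wt₂ P x * rarePair o x = coincidence o P := by
  simp only [rarePair, Finset.mul_sum, coincidence]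
  rw [Summable.tsum_finsetSum fun _ _ => ENNReal.summable]
  refine Finset.sum_congr rfl fun r _ => ?_
  simp [wt₂, wt_cons, sq]

variable (o) in
/-- The weight `f` of the pair of lists that remains when a common last rare letter is removed. -/
noncomputable def rareEnd (f : List A × List A → ℝ≥0∞) : List A × List A → ℝ≥0∞ :=
  conv f (rarePair o)

theorem le_rareEnd (f : List A × List A → ℝ≥0∞) {r : A} (hr : r ≠ o) (a b : List A) :
    f (a, b) ≤ rareEnd o f (a ++ [r], b ++ [r]) := by
  refine le_trans (le_mul_of_one_le_right' ?_) (mul_le_conv f (rarePair o) a b [r] [r])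
  refine le_trans (by simp) (Finset.single_le_sum (f := fun s =>
    if (([r], [r]) : List A × List A) = ([s], [s]) then (1 : ℝ≥0∞) else 0) (fun _ _ => zero_le)
    (Finset.mem_erase.2 ⟨hr, Finset.mem_univ r⟩))

theorem tsum_wt₂_mul_rareEnd (f : List A × List A → ℝ≥0∞) :
    ∑' x, wt₂ P x * rareEnd o f x = (∑' a, wt₂ P a * f a) * coincidence o P := by
  rw [rareEnd, tsum_wt₂_mul_conv, tsum_wt₂_mul_rarePair]

theorem PairAutomaton.Reaches.rareEnd_step {S : Type*} [Fintype S] {M : PairAutomaton A S}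
    {s s' : S} {x y : List A} {t w : ℝ≥0∞} {f : List A × List A → ℝ≥0∞}
    (h : M.Reaches s' x y t) {r : A} (hr : r ≠ o) {a b : List A} (hw : w ≤ f (a, b))
    (hf : ∀ x, rareEnd o f x ≤ M.step s s' x) :
    M.Reaches s (a ++ r :: x) (b ++ r :: y) (w * t) := by
  have := h.step (hw.trans ((le_rareEnd f hr a b).trans (hf _)))
  rwa [append_assoc, append_assoc, singleton_append, singleton_append] at this

end Laws

section MatchedRares

variable {A : Type*} [DecidableEq A] {o : A}

/-- Weight `1/2` per letter `o` left over and weight `ζ` per matched pair of letters `o`. -/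
noncomputable def gapWeight (o : A) (ζ : ℝ≥0∞) (x : List A × List A) : ℝ≥0∞ :=
  2⁻¹ ^ gap o x.1 x.2 * ζ ^ min (x.1.count o) (x.2.count o)

theorem gapWeight_le_one {ζ : ℝ≥0∞} (hζ : ζ ≤ 1) (x : List A × List A) : gapWeight o ζ x ≤ 1 :=
  mul_le_one' (pow_le_one' (by simp) _) (pow_le_one' hζ _)

variable [Fintype A]

/-- Reads the segments of an alignment one by one, with the weight `gapWeight`, and an additional
weight `16` per matched pair of rare letters. -/
noncomputable def segmentAutomaton (o : A) (ζ : ℝ≥0∞) : PairAutomaton A Unit where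
  step _ _ := rareEnd o fun x => 16 * gapWeight o ζ x
  final _ := gapWeight o ζ

theorem Alignment.reaches_segmentAutomaton (ζ : ℝ≥0∞) {x y : List A} (α : Alignment o x y) :
    (segmentAutomaton o ζ).Reaches () x y
      (16 ^ α.rareMatches * 2⁻¹ ^ α.unmatched * ζ ^ α.commonMatches) := by
  induction α with
  | last a b => exact .of_final (by simp [rareMatches, unmatched, commonMatches, segmentAutomaton,
      gapWeight])
  | cons a b r hr α ih =>
    convert ih.rareEnd_step hr (f := fun x => 16 * gapWeight o ζ x) le_rfl (fun _ => le_rfl) using 1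
    simp only [rareMatches, unmatched, commonMatches, gapWeight]
    ring

variable {P : A → ℝ≥0∞} {ζ : ℝ≥0∞}

theorem IsLaw.tsum_wt₂_mul_gapWeight_le (hP : IsLaw o P) :
    ∑' x, wt₂ P x * gapWeight o ζ x ≤ (P o)⁻¹ ^ 2 * (4 * (1 - ζ)⁻¹) := by
  let F (i j : ℕ) : ℝ≥0∞ := 2⁻¹ ^ Nat.dist i j * ζ ^ min i j
  have hgeom : ∑' d : ℕ, (2⁻¹ : ℝ≥0∞) ^ d = 2 := by
    rw [ENNReal.tsum_geometric, ENNReal.one_sub_inv_two, inv_inv]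
  have hright (i d : ℕ) : F i (i + d) = ζ ^ i * 2⁻¹ ^ d := by simp [F, Nat.dist, mul_comm]
  have hleft (i d : ℕ) : F (i + d) i = ζ ^ i * 2⁻¹ ^ d := by simp [F, Nat.dist, mul_comm]
  refine (hP.tsum_wt₂_mul_count_le F).trans ?_
  gcongr
  refine (tsum_tsum_le_add F).trans_eq ?_
  simp only [hright, hleft, ENNReal.tsum_mul_left, ENNReal.tsum_mul_right, hgeom,
    ENNReal.tsum_geometric]
  ring

theorem IsLaw.mul_sum_wt₂_le_two (hP : IsLaw o P) (hζ : ζ ≤ 1)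
    (hmass : coincidence o P * ((P o)⁻¹ ^ 2 * (64 * (1 - ζ)⁻¹)) ≤ 2⁻¹) (n : ℕ) (t : ℝ≥0∞)
    (B : Finset ((Fin n → A) × (Fin n → A)))
    (hB : ∀ x ∈ B, ∃ α : Alignment o (ofFn x.1) (ofFn x.2),
      t ≤ 16 ^ α.rareMatches * 2⁻¹ ^ α.unmatched * ζ ^ α.commonMatches) :
    t * ∑ x ∈ B, wt₂ P (ofFn x.1, ofFn x.2) ≤ 2 := by
  have hstep : ∑' a, wt₂ P a * (segmentAutomaton o ζ).step () () a ≤ 2⁻¹ := by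
    refine le_trans ?_ hmass
    calc ∑' a, wt₂ P a * (segmentAutomaton o ζ).step () () a
        = 16 * (∑' x, wt₂ P x * gapWeight o ζ x) * coincidence o P := by
          simp only [segmentAutomaton, tsum_wt₂_mul_rareEnd, mul_left_comm _ (16 : ℝ≥0∞),
            ENNReal.tsum_mul_left]
      _ ≤ 16 * ((P o)⁻¹ ^ 2 * (4 * (1 - ζ)⁻¹)) * coincidence o P := by
          gcongr
          exact hP.tsum_wt₂_mul_gapWeight_le
      _ = coincidence o P * ((P o)⁻¹ ^ 2 * (64 * (1 - ζ)⁻¹)) := by ring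
  refine PairAutomaton.mul_sum_wt₂_le_of_reaches P (M := segmentAutomaton o ζ) (C := fun _ => 1)
    (φ := fun _ => 2) (fun _ => hP.lenSum_le (gapWeight_le_one hζ)) (fun _ => ?_) () n t B
    fun x hx => ?_
  · rw [Fintype.sum_unique]
    calc 1 + (∑' a, wt₂ P a * (segmentAutomaton o ζ).step () () a) * 2 ≤ 1 + 2⁻¹ * 2 := by gcongr
      _ = 2 := by
        rw [ENNReal.inv_mul_cancel (by simp) (by simp)]
        norm_num
  · obtain ⟨α, hα⟩ := hB x hx
    obtain ⟨N, hN⟩ := α.reaches_segmentAutomaton ζ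
    exact ⟨N, hα.trans hN⟩

end MatchedRares

/-! ### Groups of two frequent letters -/

section Diagonal

variable {A : Type*} {o : A}

variable (o) in
/-- The lists can be aligned, matching `v` pairs of letters, so that for every `i` the `i`-th
letter `o` of one is matched with the `i`-th letter `o` of the other. -/
inductive Diagonal : List A → List A → ℕ → Prop
  | nil : Diagonal [] [] 0
  | left {a b : List A} {v : ℕ} (r : A) (hr : r ≠ o) (h : Diagonal a b v) : Diagonal (r :: a) b v
  | right {a b : List A} {v : ℕ} (r : A) (hr : r ≠ o) (h : Diagonal a b v) : Diagonal a (r :: b) v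
  | both {a b : List A} {v : ℕ} (c : A) (h : Diagonal a b v) :
      Diagonal (c :: a) (c :: b) (v + 1)

namespace Diagonal

variable {a b a' b' : List A} {v v' : ℕ}

theorem commonSublist (h : Diagonal o a b v) : CommonSublist a b v := by
  induction h with
  | nil => exact ⟨[], .refl _, .refl _, le_rfl⟩
  | left _ _ _ ih =>
    obtain ⟨l, ha, hb, hl⟩ := ih
    exact ⟨l, ha.cons _, hb, hl⟩
  | right _ _ _ ih =>
    obtain ⟨l, ha, hb, hl⟩ := ih
    exact ⟨l, ha, hb.cons _, hl⟩
  | both c _ ih => exact ih.cons c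

theorem append (h : Diagonal o a b v) (h' : Diagonal o a' b' v') :
    Diagonal o (a ++ a') (b ++ b') (v + v') := by
  induction h with
  | nil => simpa using h'
  | left r hr _ ih => exact ih.left r hr
  | right r hr _ ih => exact ih.right r hr
  | both c _ ih => exact Nat.add_right_comm .. ▸ ih.both c

variable [DecidableEq A]

theorem count_eq (h : Diagonal o a b v) : a.count o = b.count o := by
  induction h with
  | nil => rfl
  | left r hr _ ih => simpa [count_cons, hr] using ih
  | right r hr _ ih => simpa [count_cons, hr] using ih
  | both c _ ih => simp [count_cons, ih]

theorem of_count_eq (h : a.count o = b.count o) : Diagonal o a b (a.count o) := by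
  induction a generalizing b with
  | nil =>
    induction b with
    | nil => exact nil
    | cons d b ih =>
      by_cases hd : d = o
      · simp [hd] at h
      · exact (ih (by simpa [count_cons, hd] using h)).right d hd
  | cons c a ih =>
    by_cases hc : c = o
    · subst hc
      induction b with
      | nil => simp at h
      | cons d b ih' =>
        by_cases hd : d = c
        · subst hd
          rw [count_cons_self]
          exact (ih (by simpa using h)).both _
        · exact (ih' (by simpa [count_cons, hd] using h)).right d hd
    · rw [count_cons_of_ne (by simpa using hc)] at h ⊢
      exact (ih h).left c hc

theorem exists_rare_match (h : Diagonal o a b v) (hv : a.count o < v) :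
    ∃ a₁ a₂ b₁ b₂ r, r ≠ o ∧ a = a₁ ++ r :: a₂ ∧ b = b₁ ++ r :: b₂ ∧
      a₁.count o = b₁.count o := by
  induction h with
  | nil => simp at hv
  | left r hr h ih =>
    obtain ⟨a₁, a₂, b₁, b₂, s, hs, rfl, rfl, hab⟩ := ih (by simpa [count_cons, hr] using hv)
    exact ⟨r :: a₁, a₂, b₁, b₂, s, hs, rfl, rfl, by simpa [count_cons, hr] using hab⟩
  | right r hr h ih =>
    obtain ⟨a₁, a₂, b₁, b₂, s, hs, rfl, rfl, hab⟩ := ih hv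
    exact ⟨a₁, a₂, r :: b₁, b₂, s, hs, rfl, rfl, by simpa [count_cons, hr] using hab⟩
  | @both a b v c h ih =>
    by_cases hc : c = o
    · subst hc
      obtain ⟨a₁, a₂, b₁, b₂, s, hs, rfl, rfl, hab⟩ := ih (by simpa using hv)
      exact ⟨c :: a₁, a₂, c :: b₁, b₂, s, hs, rfl, rfl, by simpa using hab⟩
    · exact ⟨[], a, [], b, c, hc, rfl, rfl, rfl⟩

end Diagonal

variable [DecidableEq A]

variable (o) in
/-- `g` ends with `o` and has `k` other letters `o`. -/
def IsBlock (k : ℕ) (g : List A) : Prop := ∃ l, g = l ++ [o] ∧ l.count o = k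

namespace IsBlock

variable {k : ℕ} {g : List A}

theorem cons_of_ne (h : IsBlock o k g) {r : A} (hr : r ≠ o) : IsBlock o k (r :: g) := by
  obtain ⟨l, rfl, h⟩ := h
  exact ⟨r :: l, rfl, by simpa [count_cons, hr] using h⟩

theorem cons_self (h : IsBlock o k g) : IsBlock o (k + 1) (o :: g) := by
  obtain ⟨l, rfl, h⟩ := h
  exact ⟨o :: l, rfl, by simpa using h⟩

theorem count_eq (h : IsBlock o k g) : g.count o = k + 1 := by
  obtain ⟨l, rfl, h⟩ := h
  simp [h]

theorem of_append_cons {a b : List A} {r : A} (h : IsBlock o k (a ++ r :: b)) (hr : r ≠ o) :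
    ∃ j, IsBlock o j b ∧ a.count o + j = k := by
  obtain ⟨l, hl, hk⟩ := h
  rcases eq_nil_or_concat b with rfl | ⟨b, c, rfl⟩
  · have hlast := congrArg getLast? hl
    rw [getLast?_concat, getLast?_concat, Option.some.injEq] at hlast
    exact absurd hlast hr
  · have happend : (a ++ r :: b) ++ [c] = l ++ [o] := by simpa using hl
    obtain ⟨rfl, hc⟩ := append_inj' happend rfl
    obtain ⟨rfl, -⟩ := cons.inj hc
    refine ⟨b.count c, ⟨b, by simp, rfl⟩, ?_⟩
    rw [← hk, count_append, count_cons_of_ne (by simpa using hr)]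

end IsBlock

theorem Diagonal.exists_split {a b : List A} {v : ℕ} (h : Diagonal o a b v) (k : ℕ)
    (hk : k < a.count o) : ∃ g a' g' b' v₁ v₂, a = g ++ a' ∧ b = g' ++ b' ∧ v = v₁ + v₂ ∧
      Diagonal o g g' v₁ ∧ Diagonal o a' b' v₂ ∧ IsBlock o k g ∧ IsBlock o k g' := by
  induction h generalizing k with
  | nil => simp at hk
  | left r hr h ih =>
    obtain ⟨g, a', g', b', v₁, v₂, rfl, rfl, rfl, hg, ha, hk, hk'⟩ :=
      ih k (by simpa [count_cons, hr] using hk)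
    exact ⟨r :: g, a', g', b', v₁, v₂, rfl, rfl, rfl, hg.left r hr, ha, hk.cons_of_ne hr, hk'⟩
  | right r hr h ih =>
    obtain ⟨g, a', g', b', v₁, v₂, rfl, rfl, rfl, hg, ha, hk, hk'⟩ := ih k hk
    exact ⟨g, a', r :: g', b', v₁, v₂, rfl, rfl, rfl, hg.right r hr, ha, hk, hk'.cons_of_ne hr⟩
  | @both a b v c h ih =>
    by_cases hc : c = o
    · subst hc
      cases k with
      | zero =>
        exact ⟨[c], a, [c], b, 1, v, rfl, rfl, add_comm _ _, nil.both c, h, ⟨[], rfl, rfl⟩,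
          ⟨[], rfl, rfl⟩⟩
      | succ k =>
        obtain ⟨g, a', g', b', v₁, v₂, rfl, rfl, rfl, hg, ha, hk, hk'⟩ :=
          ih k (by simpa using hk)
        exact ⟨c :: g, a', c :: g', b', v₁ + 1, v₂, rfl, rfl, by omega, hg.both c, ha,
          hk.cons_self, hk'.cons_self⟩
    · obtain ⟨g, a', g', b', v₁, v₂, rfl, rfl, rfl, hg, ha, hk, hk'⟩ :=
        ih k (by simpa [count_cons, hc] using hk)
      exact ⟨c :: g, a', c :: g', b', v₁ + 1, v₂, rfl, rfl, by omega, hg.both c, ha,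
        hk.cons_of_ne hc, hk'.cons_of_ne hc⟩

end Diagonal

section GroupPairs

variable {A : Type*} {o : A}

variable (o) in
/-- The pair `(r o o, o r o)`, in which the letter `r` can be matched at the cost of one letter
`o`. -/
def ShiftPair (g g' : List A) : Prop := ∃ r, r ≠ o ∧ g = [r, o, o] ∧ g' = [o, r, o]

variable (o) in
/-- The pair has a diagonal alignment with at least three matches. -/
def RichPair (g g' : List A) : Prop := ∃ v, 2 < v ∧ Diagonal o g g' v

variable (o) in
/-- The pair is neither rich nor a shift pair. -/
def PlainPair (g g' : List A) : Prop := ¬ RichPair o g g' ∧ ¬ ShiftPair o g g'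

theorem ShiftPair.not_richPair {g g' : List A} (hg : ShiftPair o g g') : ¬ RichPair o g g' := by
  classical
  rintro ⟨v, hv, hd⟩
  obtain ⟨r, hr, rfl, rfl⟩ := hg
  obtain ⟨a₁, a₂, b₁, b₂, s, hs, ha, hb, hab⟩ := hd.exists_rare_match (by simpa [hr] using hv)
  rcases a₁ with _ | ⟨c, a₁⟩
  · rcases b₁ with _ | ⟨d, b₁⟩
    · exact hs (cons.inj hb).1.symm
    · simp [(cons.inj hb).1.symm] at hab
  · have hmem : s ∈ [o, o] := by rw [(cons.inj ha).2]; simp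
    exact hs (by simpa using hmem)

variable [DecidableEq A]

variable (o) in
/-- Both lists end with `o` and have two letters `o`. -/
def GroupPair (g g' : List A) : Prop := IsBlock o 1 g ∧ IsBlock o 1 g'

variable {g g' h h' k k' : List A}

theorem ShiftPair.count_left (hg : ShiftPair o g g') : g.count o = 2 := by
  obtain ⟨r, hr, rfl, rfl⟩ := hg
  simp [hr]

theorem ShiftPair.count_right (hg : ShiftPair o g g') : g'.count o = 2 := by
  obtain ⟨r, hr, rfl, rfl⟩ := hg
  simp [hr]

/-- Between the two matched rare letters the `o`s of the first word are shifted by one against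
those of the second, so that only two of the `o`s of each word are left over. -/
theorem ShiftPair.commonSublist (hg : ShiftPair o g g') (hh : ShiftPair o h h')
    (hk : k.count o = k'.count o) :
    CommonSublist (g ++ k ++ h) (g' ++ k' ++ h') (k.count o + 5) := by
  obtain ⟨r, -, rfl, rfl⟩ := hg
  obtain ⟨s, -, rfl, rfl⟩ := hh
  have hfirst : CommonSublist [] [o] 0 := ⟨[], by simp, by simp, by simp⟩
  have hmiddle : CommonSublist ([o, o] ++ k) ([o] ++ k' ++ [o]) (k.count o + 2) :=
    commonSublist_of_le_count o (by simp) (by simp [hk])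
  have hlast : CommonSublist [o, o] [o] 1 := ⟨[o], by simp, by simp, by simp⟩
  have := (hfirst.append (hmiddle.append (hlast.cons s) |>.cons r)).mono
    (by omega : k.count o + 5 ≤ _)
  simpa using this

end GroupPairs

/-! ### Runs of segments with equally many frequent letters -/

section Runs

variable {A : Type*} [DecidableEq A] {o : A}

variable (o) in
/-- A shift pair, and then two lists with equally many letters `o`, can be put in front of `a` and
`b` so that one cannot do better than match their letters `o` and `v` further pairs of letters. -/
def AfterShift (a b : List A) (v : ℕ) : Prop :=
  ∃ h h' k k', ShiftPair o h h' ∧ k.count o = k'.count o ∧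
    MaxCommon (h ++ k ++ a) (h' ++ k' ++ b) (2 + k.count o + v)

variable (o) in
/-- The optimality of `v` matches that is maintained along a run, which depends on whether a shift
pair has been read after the last rich pair. -/
def RunOptimal : Bool → List A → List A → ℕ → Prop
  | false => MaxCommon
  | true => AfterShift o

variable (o) in
/-- The kinds of group pairs that change, from the first to the second value, the flag which says
whether a shift pair has been read after the last rich pair. -/
def GroupStep : Bool → Bool → List A → List A → Prop
  | false, false => fun g g' => ¬ ShiftPair o g g'
  | false, true => ShiftPair o
  | true, false => RichPair o
  | true, true => PlainPair o

variable {a b g g' : List A} {v v' : ℕ}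

theorem AfterShift.mono (h : AfterShift o a b v) (hv : v ≤ v') : AfterShift o a b v' :=
  let ⟨h, h', k, k', hh, hk, hmax⟩ := h
  ⟨h, h', k, k', hh, hk, fun j hj => (hmax j hj).trans (Nat.add_le_add_left hv _)⟩

theorem AfterShift.of_shiftPair (hg : ShiftPair o g g')
    (h : MaxCommon (g ++ a) (g' ++ b) (2 + v)) : AfterShift o a b v :=
  ⟨g, g', [], [], hg, rfl, by simpa using h⟩

theorem AfterShift.append (h : AfterShift o (g ++ a) (g' ++ b) (v + v')) (hg : g.count o = v)
    (hg' : g'.count o = v) : AfterShift o a b v' := by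
  obtain ⟨h, h', k, k', hh, hk, hmax⟩ := h
  refine ⟨h, h', k ++ g, k' ++ g', hh, by simp [hk, hg, hg'], fun j hj => ?_⟩
  have := hmax j (by simpa using hj)
  rw [count_append, hg]
  omega

theorem AfterShift.maxCommon (h : AfterShift o (g ++ a) (g' ++ b) (v + v'))
    (hg : CommonSublist g g' v) : MaxCommon a b v' := by
  obtain ⟨h, h', k, k', hh, hk, hmax⟩ := h
  rw [← add_assoc, ← append_assoc, ← append_assoc] at hmax
  refine hmax.of_append_right (CommonSublist.append ?_ hg)
  exact commonSublist_of_le_count o (by rw [count_append, hh.count_left])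
    (by rw [count_append, hh.count_right, hk])

theorem AfterShift.not_shiftPair (h : AfterShift o (g ++ a) (g' ++ b) (v + v')) (hv : v ≤ 2)
    (hab : CommonSublist a b v') : ¬ ShiftPair o g g' := by
  intro hg
  obtain ⟨h, h', k, k', hh, hk, hmax⟩ := h
  have := hmax _ (by simpa using (hh.commonSublist hg hk).append hab)
  omega

/-- Two shift pairs with no rich pair in between are excluded by `ShiftPair.commonSublist`. -/
theorem RunOptimal.exists_groupStep {s : Bool} (h : RunOptimal o s (g ++ a) (g' ++ b) (v + v'))
    (hgroup : GroupPair o g g') (hg : Diagonal o g g' v) (hab : CommonSublist a b v') :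
    ∃ s', GroupStep o s s' g g' ∧ RunOptimal o s' a b v' := by
  have hv : ¬ RichPair o g g' → v ≤ 2 := fun hrich => not_lt.1 fun hv => hrich ⟨v, hv, hg⟩
  have hmax : MaxCommon a b v' := by
    cases s with
    | false => exact MaxCommon.of_append_right h hg.commonSublist
    | true => exact AfterShift.maxCommon h hg.commonSublist
  by_cases hshift : ShiftPair o g g'
  · cases s with
    | false => exact ⟨true, hshift, .of_shiftPair hshift fun j hj =>
        (h j hj).trans (Nat.add_le_add_right (hv hshift.not_richPair) _)⟩
    | true => exact absurd hshift (AfterShift.not_shiftPair h (hv hshift.not_richPair) hab)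
  · cases s with
    | false => exact ⟨false, hshift, hmax⟩
    | true =>
      by_cases hrich : RichPair o g g'
      · exact ⟨false, hrich, hmax⟩
      · refine ⟨true, ⟨hrich, hshift⟩, AfterShift.append (v := 2) ?_ hgroup.1.count_eq
          hgroup.2.count_eq⟩
        exact AfterShift.mono h (Nat.add_le_add_right (hv hrich) _)

end Runs

section RunAutomaton

/-- The weights per matched letter `o`, per unmatched letter `o` and per rare letter of a segment
with fewer letters `o` than its partner, and of the last pair of segments. -/
structure SegmentWeights where
  matched : ℝ≥0∞
  unmatched : ℝ≥0∞
  poorRare : ℝ≥0∞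
  final : ℝ≥0∞

/-- Within a run of segments with equally many letters `o`, with the flag of `GroupStep`; after the
end of a run; or at the beginning and after a pair of segments with different numbers of `o`. -/
inductive RunState
  | run (shifted : Bool)
  | closed
  | fresh

instance : Fintype RunState where
  elems := ⟨{.run false, .run true, .closed, .fresh}, by simp⟩
  complete := by rintro ((_ | _) | _ | _) <;> simp

theorem RunState.sum_eq {M : Type*} [AddCommMonoid M] (f : RunState → M) :
    ∑ s, f s = f (.run false) + (f (.run true) + (f .closed + f .fresh)) := by
  change (Multiset.map f {.run false, .run true, .closed, .fresh}).sum = _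
  simp

variable {A : Type*} [DecidableEq A]

namespace SegmentWeights

variable (w : SegmentWeights) (o : A)

/-- The weight of a pair of segments. -/
noncomputable def segment (x : List A × List A) : ℝ≥0∞ :=
  w.matched ^ min (x.1.count o) (x.2.count o) * w.unmatched ^ gap o x.1 x.2 *
    w.poorRare ^ raresOfPoorer o x.1 x.2

/-- The weight of the end of a run, after its groups have been removed. -/
noncomputable def short (x : List A × List A) : ℝ≥0∞ :=
  if x.1.count o = x.2.count o ∧ x.1.count o < 2 then w.matched ^ x.1.count o else 0

/-- The weight of a pair of segments with different numbers of letters `o`. -/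
noncomputable def unequal (x : List A × List A) : ℝ≥0∞ :=
  if x.1.count o = x.2.count o then 0 else w.segment o x

variable {o} in
/-- The weight of an alignment. -/
noncomputable def alignment {x y : List A} (α : Alignment o x y) : ℝ≥0∞ :=
  w.final * (w.matched ^ α.commonMatches * w.unmatched ^ α.unmatched * w.poorRare ^ α.poorRares)

variable {w o} {a b x y : List A}

theorem segment_of_count_eq (h : a.count o = b.count o) :
    w.segment o (a, b) = w.matched ^ a.count o := by
  simp [segment, gap, raresOfPoorer, h, Nat.dist]

theorem short_eq (h : a.count o = b.count o) (ha : a.count o < 2) :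
    w.short o (a, b) = w.matched ^ a.count o := if_pos ⟨h, ha⟩

theorem unequal_eq (h : a.count o ≠ b.count o) : w.unequal o (a, b) = w.segment o (a, b) :=
  if_neg h

theorem alignment_last :
    w.alignment (.last a b : Alignment o a b) = w.final * w.segment o (a, b) := rfl

theorem alignment_cons {r : A} (hr : r ≠ o) (α : Alignment o x y) :
    w.alignment (.cons a b r hr α) = w.segment o (a, b) * w.alignment α := by
  simp only [alignment, segment, Alignment.commonMatches, Alignment.unmatched,
    Alignment.poorRares]
  ring

end SegmentWeights

variable (o : A)

open scoped Classical in
/-- The indicator of the group pairs that satisfy `p`. -/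
noncomputable def groupIndicator (p : List A → List A → Prop) (x : List A × List A) : ℝ≥0∞ :=
  if GroupPair o x.1 x.2 ∧ p x.1 x.2 then 1 else 0

variable [Fintype A]

/-- Reads alignments segment by segment, where runs of pairs of segments with equally many letters
`o` are cut into groups with two letters `o` instead. -/
noncomputable def runAutomaton (w : SegmentWeights) : PairAutomaton A RunState where
  step
    | .run s, .run s' => fun x => w.matched ^ 2 * groupIndicator o (GroupStep o s s') x
    | .fresh, .run s' => fun x => w.matched ^ 2 * groupIndicator o (GroupStep o false s') x
    | .run _, .closed | .fresh, .closed => rareEnd o (w.short o)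
    | .closed, .fresh | .fresh, .fresh => rareEnd o (w.unequal o)
    | .run _, .fresh | .closed, .run _ | .closed, .closed => 0
  final
    | .run _ => fun x => w.final * w.short o x
    | .closed => fun x => w.final * w.unequal o x
    | .fresh => fun x => w.final * (w.short o x + w.unequal o x)

variable {o} {w : SegmentWeights} {a b x y : List A} {t : ℝ≥0∞} {v k : ℕ} {s : Bool} {r : A}

theorem reaches_fresh_of_run (h : (runAutomaton o w).Reaches (.run false) x y t) :
    (runAutomaton o w).Reaches .fresh x y t := by
  refine h.of_state_le (fun x => mul_le_mul_right le_self_add _) fun q x => ?_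
  rcases q with q | _ | _
  · exact le_rfl
  · exact le_rfl
  · exact zero_le

theorem Diagonal.reaches_run_of_short (hd : Diagonal o a b v) (h : RunOptimal o s a b v)
    (hshort : ∀ s a b, a.count o = b.count o → a.count o < 2 →
      (runAutomaton o w).Reaches (.run s) (a ++ x) (b ++ y) (w.matched ^ a.count o * t)) :
    (runAutomaton o w).Reaches (.run s) (a ++ x) (b ++ y) (w.matched ^ a.count o * t) := by
  induction hn : a.count o using Nat.strong_induction_on generalizing a b v s with
  | _ n ih =>
    subst hn
    by_cases ha : a.count o < 2
    · exact hshort s a b hd.count_eq ha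
    obtain ⟨g, a', g', b', v₁, v₂, rfl, rfl, rfl, hg, hd', hgroup⟩ :=
      hd.exists_split 1 (by omega)
    obtain ⟨s', hstep, hopt⟩ := h.exists_groupStep hgroup hg hd'.commonSublist
    have hcount : (g ++ a').count o = 2 + a'.count o := by rw [count_append, hgroup.1.count_eq]
    have hweight : w.matched ^ 2 ≤ (runAutomaton o w).step (.run s) (.run s') (g, g') := by
      simp [runAutomaton, groupIndicator, hgroup, GroupPair, hstep]
    rw [hcount, pow_add, mul_assoc, append_assoc, append_assoc]
    exact (ih _ (by omega) hd' hopt rfl).step hweight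

theorem Diagonal.reaches_run (hd : Diagonal o a b v) (h : MaxCommon a b v) :
    (runAutomaton o w).Reaches (.run false) a b (w.matched ^ a.count o * w.final) := by
  have := hd.reaches_run_of_short (s := false) (x := []) (y := []) (t := w.final) (w := w) h
    fun s a b hab ha => .of_final (by
      simp [runAutomaton, SegmentWeights.short_eq hab ha, mul_comm])
  simpa using this

variable (o w) in
/-- Any two lists with equally many letters `o`, followed by a matched rare letter, can be read in
front of `x` and `y`, whose longest common subsequence has length `k`, if they can be part of an
optimal alignment. -/
def ReachesAfterRun (x y : List A) (k : ℕ) (t : ℝ≥0∞) : Prop :=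
  ∀ ⦃a b : List A⦄ ⦃v : ℕ⦄ ⦃r : A⦄, r ≠ o → Diagonal o a b v →
    MaxCommon (a ++ r :: x) (b ++ r :: y) (v + (k + 1)) →
      (runAutomaton o w).Reaches (.run false) (a ++ r :: x) (b ++ r :: y)
        (w.matched ^ a.count o * t)

theorem ReachesAfterRun.of_closed (hxy : CommonSublist x y k)
    (h : MaxCommon x y k → (runAutomaton o w).Reaches .closed x y t) :
    ReachesAfterRun o w x y k t := by
  intro a b v r hr hd hmax
  have hclosed := h (hmax.of_append_cons hd.commonSublist)
  exact hd.reaches_run_of_short (s := false) (hmax.of_append_left (hxy.cons r))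
    fun _ _ _ hab ha => hclosed.rareEnd_step hr (SegmentWeights.short_eq hab ha).ge fun _ => le_rfl

theorem ReachesAfterRun.of_count_eq (hab : a.count o = b.count o) :
    ReachesAfterRun o w a b (a.count o) (w.matched ^ a.count o * w.final) := by
  intro a₀ b₀ v r hr hd hmax
  have := (hd.append ((Diagonal.of_count_eq hab).both r)).reaches_run (w := w) hmax
  rwa [count_append, count_cons_of_ne (by simpa using hr), pow_add, mul_assoc] at this

theorem ReachesAfterRun.cons (h : ReachesAfterRun o w x y k t) (hab : a.count o = b.count o)
    (hr : r ≠ o) : ReachesAfterRun o w (a ++ r :: x) (b ++ r :: y) (a.count o + (k + 1))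
      (w.matched ^ a.count o * t) := by
  intro a₀ b₀ v r₀ hr₀ hd hmax
  have := h hr (hd.append ((Diagonal.of_count_eq hab).both r₀)) (by
    simpa [add_assoc, add_left_comm, add_comm] using hmax)
  rw [count_append, count_cons_of_ne (by simpa using hr₀), pow_add, mul_assoc] at this
  simpa using this

theorem reaches_cons_unequal (hab : a.count o ≠ b.count o) (hr : r ≠ o)
    (h : (runAutomaton o w).Reaches .fresh x y t) {s : RunState} (hs : s = .closed ∨ s = .fresh) :
    (runAutomaton o w).Reaches s (a ++ r :: x) (b ++ r :: y) (w.segment o (a, b) * t) := by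
  rcases hs with rfl | rfl <;>
  exact h.rareEnd_step hr (SegmentWeights.unequal_eq hab).ge fun _ => le_rfl

theorem Alignment.reaches_last (a b : List A) :
    (MaxCommon a b (min (a.count o) (b.count o)) →
      (runAutomaton o w).Reaches .fresh a b (w.final * w.segment o (a, b))) ∧
      ReachesAfterRun o w a b (min (a.count o) (b.count o)) (w.final * w.segment o (a, b)) := by
  by_cases hab : a.count o = b.count o
  · rw [SegmentWeights.segment_of_count_eq hab, ← hab, min_self, mul_comm]
    exact ⟨fun hmax => reaches_fresh_of_run ((Diagonal.of_count_eq hab).reaches_run hmax),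
      .of_count_eq hab⟩
  · rw [← SegmentWeights.unequal_eq hab]
    exact ⟨fun _ => .of_final (mul_le_mul_right le_add_self _),
      .of_closed (commonSublist_of_le_count o (min_le_left _ _) (min_le_right _ _))
        fun _ => .of_final le_rfl⟩

theorem Alignment.reaches_runAutomaton (α : Alignment o x y) :
    (α.IsOptimal → (runAutomaton o w).Reaches .fresh x y (w.alignment α)) ∧
      ReachesAfterRun o w x y α.size (w.alignment α) := by
  induction α with
  | last a b =>
    rw [IsOptimal, size_last, SegmentWeights.alignment_last]
    exact reaches_last a b
  | @cons a b r hr x y α ih =>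
    have hxy := (cons a b r hr α).commonSublist
    rw [IsOptimal, SegmentWeights.alignment_cons]
    rw [size_cons] at hxy ⊢
    by_cases hab : a.count o = b.count o
    · rw [SegmentWeights.segment_of_count_eq hab, ← hab, min_self]
      exact ⟨fun hmax => reaches_fresh_of_run (ih.2 hr (.of_count_eq hab) hmax),
        ih.2.cons hab hr⟩
    · have hprefix := commonSublist_of_le_count o (min_le_left (a.count o) (b.count o))
        (min_le_right _ _)
      have hcons (hmax : MaxCommon (a ++ r :: x) (b ++ r :: y)
          (min (a.count o) (b.count o) + (α.size + 1))) {s : RunState}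
          (hs : s = .closed ∨ s = .fresh) :=
        reaches_cons_unequal hab hr (ih.1 (hmax.of_append_cons hprefix)) hs
      exact ⟨fun hmax => hcons hmax (.inr rfl), .of_closed hxy fun hmax => hcons hmax (.inl rfl)⟩

end RunAutomaton

/-! ### Probabilities of groups and segments -/

section GroupMass

variable {A : Type*} [DecidableEq A] {o : A} {P : A → ℝ≥0∞}

variable (o P) in
/-- The probability of the group pairs that satisfy `p`. -/
noncomputable def groupMass (p : List A → List A → Prop) : ℝ≥0∞ :=
  ∑' x, wt₂ P x * groupIndicator o p x

theorem groupMass_or {p q : List A → List A → Prop} (h : ∀ a b, p a b → ¬ q a b) :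
    groupMass o P (fun a b => p a b ∨ q a b) = groupMass o P p + groupMass o P q := by
  simp only [groupMass, ← ENNReal.tsum_add, ← mul_add]
  refine tsum_congr fun x => congrArg _ ?_
  have := h x.1 x.2
  unfold groupIndicator
  by_cases hx : GroupPair o x.1 x.2 <;> by_cases hp : p x.1 x.2 <;> by_cases hq : q x.1 x.2 <;>
  simp_all

theorem groupMass_not_shiftPair : groupMass o P (fun a b => ¬ ShiftPair o a b) =
    groupMass o P (RichPair o) + groupMass o P (PlainPair o) := by
  rw [← groupMass_or fun a b hrich hplain => hplain.1 hrich]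
  refine congrArg _ (funext₂ fun a b => propext ?_)
  have : ShiftPair o a b → ¬ RichPair o a b := ShiftPair.not_richPair
  unfold PlainPair
  tauto

variable (o) in
open scoped Classical in
/-- The indicator of the pairs of blocks with `k + 1` letters `o`. -/
noncomputable def blockIndicator (k : ℕ) (x : List A × List A) : ℝ≥0∞ :=
  if IsBlock o k x.1 ∧ IsBlock o k x.2 then 1 else 0

theorem groupIndicator_le_blockIndicator (p : List A → List A → Prop) (x : List A × List A) :
    groupIndicator o p x ≤ blockIndicator o 1 x := by
  unfold groupIndicator blockIndicator GroupPair
  split_ifs <;> simp_all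

variable [Fintype A]

open scoped Classical in
theorem IsLaw.tsum_isBlock_le_one (hP : IsLaw o P) (k : ℕ) :
    ∑' g, (if IsBlock o k g then wt P g else 0) ≤ 1 := by
  calc ∑' g, (if IsBlock o k g then wt P g else 0)
      ≤ ∑' l : List A, (if l.count o = k then wt P (l ++ [o]) else 0) :=
        tsum_ite_exists_le (fun l => l ++ [o]) (fun l => l.count o = k) _ (fun _ hg => hg) _
    _ = (∑' l : List A, if l.count o = k then wt P l else 0) * P o := by
        rw [← ENNReal.tsum_mul_right]
        refine tsum_congr fun l => ?_
        rw [wt_append, wt_cons, wt_nil, mul_one, ite_mul, zero_mul]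
    _ ≤ (P o)⁻¹ * P o := by
        gcongr
        refine (tsum_wt_count_le P o k).trans_eq ?_
        rw [hP.one_sub_rareMass, hP.pow_mul_inv_pow_succ]
    _ = 1 := ENNReal.inv_mul_cancel hP.ne_zero hP.ne_top

theorem IsLaw.tsum_wt₂_mul_blockIndicator_le_one (hP : IsLaw o P) (k : ℕ) :
    ∑' x, wt₂ P x * blockIndicator o k x ≤ 1 := by
  classical
  calc ∑' x, wt₂ P x * blockIndicator o k x
      = (∑' g, if IsBlock o k g then wt P g else 0) *
          ∑' g, if IsBlock o k g then wt P g else 0 := by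
        rw [ENNReal.tsum_prod', ← ENNReal.tsum_mul_right]
        refine tsum_congr fun a => ?_
        rw [← ENNReal.tsum_mul_left]
        refine tsum_congr fun b => ?_
        unfold blockIndicator
        by_cases ha : IsBlock o k a <;> by_cases hb : IsBlock o k b <;> simp [ha, hb, wt₂]
    _ ≤ 1 := mul_le_one' (hP.tsum_isBlock_le_one k) (hP.tsum_isBlock_le_one k)

theorem IsLaw.groupMass_le_one (hP : IsLaw o P) (p : List A → List A → Prop) :
    groupMass o P p ≤ 1 :=
  (ENNReal.tsum_le_tsum fun x => mul_le_mul_right (groupIndicator_le_blockIndicator p x) _).trans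
    (hP.tsum_wt₂_mul_blockIndicator_le_one 1)

theorem IsLaw.groupMass_not_shiftPair_add_le_one (hP : IsLaw o P) :
    groupMass o P (fun a b => ¬ ShiftPair o a b) + groupMass o P (ShiftPair o) ≤ 1 := by
  rw [← groupMass_or fun a b => id]
  exact hP.groupMass_le_one _

theorem coincidence_mul_le_groupMass_shiftPair :
    coincidence o P * P o ^ 4 ≤ groupMass o P (ShiftPair o) := by
  let f (r : A) : List A × List A := ([r, o, o], [o, r, o])
  have hf : Function.Injective f := fun r s h => by simpa [f] using h
  refine le_trans ?_ (ENNReal.tsum_comp_le_tsum_of_injective hf _)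
  rw [tsum_fintype, coincidence, Finset.sum_mul]
  refine (Finset.sum_le_sum fun r hr => ?_).trans
    (Finset.sum_le_sum_of_subset (Finset.erase_subset o Finset.univ))
  have hr := Finset.ne_of_mem_erase hr
  have hone : groupIndicator o (ShiftPair o) (f r) = 1 :=
    if_pos ⟨⟨⟨[r, o], rfl, by simp [hr]⟩, ⟨[o, r], rfl, by simp [hr]⟩⟩, r, hr, rfl, rfl⟩
  rw [hone]
  simp only [f, wt₂, wt_cons, wt_nil]
  exact le_of_eq (by ring)

variable (o) in
/-- The indicator of the pairs of lists with `k` letters `o` each. -/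
noncomputable def countIndicator (k : ℕ) (x : List A × List A) : ℝ≥0∞ :=
  if x.1.count o = k ∧ x.2.count o = k then 1 else 0

theorem IsLaw.tsum_wt₂_mul_countIndicator_le (hP : IsLaw o P) (k : ℕ) :
    ∑' x, wt₂ P x * countIndicator o k x ≤ (P o)⁻¹ ^ 2 := by
  refine (hP.tsum_wt₂_mul_count_le fun i j => if i = k ∧ j = k then 1 else 0).trans_eq ?_
  rw [tsum_eq_single k (by simp_all), tsum_eq_single k (by simp_all)]
  simp

theorem groupIndicator_richPair_le (x : List A × List A) : groupIndicator o (RichPair o) x ≤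
    ∑ k : Fin 2, conv (rareEnd o (countIndicator o k)) (blockIndicator o (1 - k)) x := by
  unfold groupIndicator
  split_ifs with h
  · obtain ⟨⟨hx, hy⟩, v, hv, hd⟩ := h
    obtain ⟨x, y⟩ := x
    obtain ⟨a, a', b, b', r, hr, rfl, rfl, hab⟩ :=
      hd.exists_rare_match (by rw [hx.count_eq]; exact hv)
    obtain ⟨j, hj, haj⟩ := hx.of_append_cons hr
    obtain ⟨j', hj', hbj⟩ := hy.of_append_cons hr
    obtain rfl : j = 1 - a.count o := by omega
    obtain rfl : j' = 1 - a.count o := by omega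
    refine le_trans ?_ (Finset.single_le_sum (fun _ _ => zero_le)
      (Finset.mem_univ (⟨a.count o, by omega⟩ : Fin 2)))
    calc (1 : ℝ≥0∞)
        = countIndicator o (a.count o) (a, b) * blockIndicator o (1 - a.count o) (a', b') := by
          rw [countIndicator, if_pos ⟨rfl, hab.symm⟩, blockIndicator, if_pos ⟨hj, hj'⟩, one_mul]
      _ ≤ rareEnd o (countIndicator o (a.count o)) (a ++ [r], b ++ [r]) *
            blockIndicator o (1 - a.count o) (a', b') := by
          gcongr
          exact le_rareEnd _ hr a b
      _ ≤ _ := by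
          simpa using mul_le_conv (rareEnd o (countIndicator o (a.count o)))
            (blockIndicator o (1 - a.count o)) (a ++ [r]) (b ++ [r]) a' b'
  · exact zero_le

theorem IsLaw.groupMass_richPair_le (hP : IsLaw o P) :
    groupMass o P (RichPair o) ≤ 2 * (coincidence o P * (P o)⁻¹ ^ 2) := by
  calc groupMass o P (RichPair o)
      ≤ ∑' x, ∑ k : Fin 2,
          wt₂ P x * conv (rareEnd o (countIndicator o k)) (blockIndicator o (1 - k)) x := by
        simp only [groupMass, ← Finset.mul_sum]
        gcongr with x
        exact groupIndicator_richPair_le x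
    _ = ∑ k : Fin 2, (∑' x, wt₂ P x * countIndicator o k x) * coincidence o P *
          ∑' x, wt₂ P x * blockIndicator o (1 - k) x := by
        rw [Summable.tsum_finsetSum fun _ _ => ENNReal.summable]
        simp only [tsum_wt₂_mul_conv, tsum_wt₂_mul_rareEnd]
    _ ≤ ∑ _k : Fin 2, (P o)⁻¹ ^ 2 * coincidence o P * 1 := by
        gcongr
        · exact hP.tsum_wt₂_mul_countIndicator_le _
        · exact hP.tsum_wt₂_mul_blockIndicator_le_one _
    _ = 2 * (coincidence o P * (P o)⁻¹ ^ 2) := by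
        rw [Fin.sum_univ_two]
        ring

end GroupMass

section SegmentMass

variable {A : Type*} [DecidableEq A] {o : A} {P : A → ℝ≥0∞}

variable (o P) in
/-- The weights `P`, with the letter `o` reweighted by `α` and the rare letters by `β`. -/
noncomputable def tilt (α β : ℝ≥0∞) (a : A) : ℝ≥0∞ := P a * if a = o then α else β

theorem wt_tilt (α β : ℝ≥0∞) (l : List A) :
    wt (tilt o P α β) l = wt P l * α ^ l.count o * β ^ rares o l := by
  induction l with
  | nil => simp [rares]
  | cons c l ih =>
    rw [wt_cons, wt_cons, ih, rares_cons, tilt]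
    by_cases h : c = o
    · subst h
      rw [count_cons_self, if_pos rfl, if_pos rfl]
      ring
    · rw [count_cons_of_ne (by simpa using h), if_neg h, if_neg h]
      ring

variable (o P) in
/-- The weighted probability of a pair of lists of which the first has fewer letters `o`. -/
noncomputable def poorerMass (w : SegmentWeights) (x : List A × List A) : ℝ≥0∞ :=
  wt (tilt o P w.matched w.poorRare) x.1 * wt P x.2 *
    if x.1.count o < x.2.count o then w.unmatched ^ (x.2.count o - x.1.count o) else 0

variable {w : SegmentWeights}

theorem wt₂_mul_unequal (x : List A × List A) :
    wt₂ P x * w.unequal o x = poorerMass o P w x + poorerMass o P w x.swap := by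
  unfold SegmentWeights.unequal SegmentWeights.segment wt₂ poorerMass gap raresOfPoorer Nat.dist
  simp only [wt_tilt, Prod.fst_swap, Prod.snd_swap]
  rcases lt_trichotomy (x.1.count o) (x.2.count o) with h | h | h
  · rw [if_neg h.ne, if_pos h, if_neg h.le.not_gt, min_eq_left h.le, if_pos h,
      Nat.sub_eq_zero_of_le h.le]
    ring
  · simp [h]
  · rw [if_neg h.ne', if_neg h.le.not_gt, if_pos h, if_pos h, if_neg h.le.not_gt,
      min_eq_right h.le, Nat.sub_eq_zero_of_le h.le]
    ring

theorem tsum_wt₂_mul_unequal :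
    ∑' x, wt₂ P x * w.unequal o x = 2 * ∑' x, poorerMass o P w x := by
  simp only [wt₂_mul_unequal]
  rw [ENNReal.tsum_add, two_mul]
  congr 1
  exact (Equiv.prodComm (List A) (List A)).tsum_eq (poorerMass o P w)

variable [Fintype A]

theorem rareMass_tilt (α β : ℝ≥0∞) : rareMass (tilt o P α β) o = rareMass P o * β := by
  rw [rareMass, rareMass, Finset.sum_mul]
  refine Finset.sum_congr rfl fun a ha => ?_
  rw [tilt, if_neg (Finset.ne_of_mem_erase ha)]

theorem sum_tilt (α β : ℝ≥0∞) : ∑ a, tilt o P α β a = P o * α + rareMass P o * β := by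
  rw [← Finset.add_sum_erase _ _ (Finset.mem_univ o), ← rareMass_tilt, tilt, if_pos rfl, rareMass]

theorem IsLaw.tsum_unequal_le (hP : IsLaw o P) {D : ℝ≥0∞} (hD : 1 - rareMass P o * w.poorRare = D) :
    ∑' x, wt₂ P x * w.unequal o x ≤
      2 * ((P o)⁻¹ * (1 - w.unmatched)⁻¹ * (D⁻¹ * (1 - P o * w.matched * D⁻¹)⁻¹)) := by
  have hgeom (i : ℕ) :
      ∑' j, (if i < j then w.unmatched ^ (j - i) else 0) ≤ (1 - w.unmatched)⁻¹ := by
    refine (tsum_ite_exists_le (fun d => i + d) (fun _ => True) (fun j => i < j)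
      (fun j hj => ⟨j - i, (Nat.add_sub_of_le hj.le).symm, trivial⟩)
      (fun j => w.unmatched ^ (j - i))).trans_eq ?_
    simp [ENNReal.tsum_geometric]
  rw [tsum_wt₂_mul_unequal]
  gcongr
  calc ∑' x, poorerMass o P w x
      ≤ ∑' i, ∑' j, (tilt o P w.matched w.poorRare o ^ i * D⁻¹ ^ (i + 1)) * (P o)⁻¹ *
          (if i < j then w.unmatched ^ (j - i) else 0) := by
        refine (tsum_wt_mul_wt_mul_count_le (tilt o P w.matched w.poorRare) P o fun i j =>
          if i < j then w.unmatched ^ (j - i) else 0).trans_eq ?_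
        simp only [rareMass_tilt, hD, hP.one_sub_rareMass, hP.pow_mul_inv_pow_succ]
    _ ≤ ∑' i, (P o)⁻¹ * (1 - w.unmatched)⁻¹ * (D⁻¹ * (P o * w.matched * D⁻¹) ^ i) := by
        gcongr with i
        rw [ENNReal.tsum_mul_left, tilt, if_pos rfl]
        refine (mul_le_mul_right (hgeom i) _).trans_eq ?_
        ring
    _ = _ := by rw [ENNReal.tsum_mul_left, ENNReal.tsum_mul_left, ENNReal.tsum_geometric]

theorem IsLaw.tsum_poorerMass_le_one (hP : IsLaw o P) (hw : w.unmatched ≤ 1)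
    (h : P o * w.matched + rareMass P o * w.poorRare ≤ 1) (n n' : ℕ) :
    ∑' x : List A × List A, (if x.1.length = n ∧ x.2.length = n' then poorerMass o P w x else 0)
      ≤ 1 := by
  let Q := tilt o P w.matched w.poorRare
  calc ∑' x : List A × List A, (if x.1.length = n ∧ x.2.length = n' then
        poorerMass o P w x else 0)
      ≤ ∑' x : List A × List A, (if x.1.length = n then wt Q x.1 else 0) *
          (if x.2.length = n' then wt P x.2 else 0) := by
        gcongr with x
        have hpow : (if x.1.count o < x.2.count o then
            w.unmatched ^ (x.2.count o - x.1.count o) else 0) ≤ 1 := by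
          split_ifs
          exacts [pow_le_one' hw _, zero_le]
        by_cases hn : x.1.length = n <;> by_cases hn' : x.2.length = n' <;> simp only [hn, hn',
          and_self, and_false, false_and, if_true, if_false, zero_le]
        exact mul_le_of_le_one_right' hpow
    _ = (∑' a : List A, if a.length = n then wt Q a else 0) *
          ∑' b : List A, if b.length = n' then wt P b else 0 := by
        rw [ENNReal.tsum_prod', ← ENNReal.tsum_mul_right]
        refine tsum_congr fun a => ?_
        rw [← ENNReal.tsum_mul_left]
    _ ≤ 1 := by
        rw [tsum_wt_length, tsum_wt_length, sum_tilt, hP.sum_eq_one, one_pow, mul_one]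
        exact pow_le_one' h n

theorem IsLaw.lenSum_unequal_le (hP : IsLaw o P) (hw : w.unmatched ≤ 1)
    (h : P o * w.matched + rareMass P o * w.poorRare ≤ 1) (n n' : ℕ) :
    lenSum P n n' (w.unequal o) ≤ 2 := by
  calc lenSum P n n' (w.unequal o)
      = ∑' x : List A × List A, ((if x.1.length = n ∧ x.2.length = n' then
          poorerMass o P w x else 0) + (if x.swap.1.length = n' ∧ x.swap.2.length = n then
          poorerMass o P w x.swap else 0)) := by
        refine tsum_congr fun x => ?_
        simp only [wt₂_mul_unequal, Prod.fst_swap, Prod.snd_swap, and_comm (a := x.2.length = n')]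
        split_ifs <;> simp
    _ ≤ 1 + 1 := by
        rw [ENNReal.tsum_add]
        refine add_le_add (hP.tsum_poorerMass_le_one hw h n n')
          (le_trans (le_of_eq ?_) (hP.tsum_poorerMass_le_one hw h n' n))
        exact (Equiv.prodComm (List A) (List A)).tsum_eq fun x =>
          if x.1.length = n' ∧ x.2.length = n then poorerMass o P w x else 0
    _ = 2 := one_add_one_eq_two

theorem IsLaw.lenSum_short_le (hP : IsLaw o P) (hw : 1 ≤ w.matched) (n n' : ℕ) :
    lenSum P n n' (w.short o) ≤ w.matched := by
  refine hP.lenSum_le (fun x => ?_) n n'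
  unfold SegmentWeights.short
  split_ifs with h
  · calc w.matched ^ x.1.count o ≤ w.matched ^ 1 := pow_le_pow_right₀ hw (by omega)
      _ = w.matched := pow_one _
  · exact zero_le

theorem IsLaw.tsum_short_le (hP : IsLaw o P) :
    ∑' x, wt₂ P x * w.short o x ≤ (P o)⁻¹ ^ 2 * (1 + w.matched) := by
  refine (hP.tsum_wt₂_mul_count_le
    fun i j => if i = j ∧ i < 2 then w.matched ^ i else 0).trans_eq ?_
  have hrow (i : ℕ) : ∑' j, (if i = j ∧ i < 2 then w.matched ^ i else 0) =
      if i < 2 then w.matched ^ i else 0 := by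
    rw [tsum_eq_single i fun j hj => by simp [hj.symm]]
    simp
  simp only [hrow]
  rw [tsum_eq_sum (s := Finset.range 2) fun i hi => by simp_all]
  simp [Finset.sum_range_succ]

end SegmentMass

/-! ### The mean weight of optimal alignments -/

section OptimalAlignments

theorem inv_sq_le_of_le {q : ℝ} (hq : 999 / 1000 ≤ q) : q⁻¹ ^ 2 ≤ 1003 / 1000 := by
  have hinv : q⁻¹ ≤ 1000 / 999 := by
    rw [inv_le_comm₀ (by linarith) (by norm_num)]
    linarith
  calc q⁻¹ ^ 2 ≤ (1000 / 999) ^ 2 := pow_le_pow_left₀ (inv_nonneg.2 (by linarith)) hinv 2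
    _ ≤ 1003 / 1000 := by norm_num

theorem ofReal_add_sum_mul_le {ι : Type*} [Fintype ι] {c d : ℝ} {N φ : ι → ℝ} {M : ι → ℝ≥0∞}
    (hc : 0 ≤ c) (hM : ∀ i, M i ≤ ENNReal.ofReal (N i)) (hN : ∀ i, 0 ≤ N i) (hφ : ∀ i, 0 ≤ φ i)
    (h : c + ∑ i, N i * φ i ≤ d) :
    ENNReal.ofReal c + ∑ i, M i * ENNReal.ofReal (φ i) ≤ ENNReal.ofReal d := by
  refine le_trans ?_ (ENNReal.ofReal_le_ofReal h)
  rw [ENNReal.ofReal_add hc (Finset.sum_nonneg fun i _ => mul_nonneg (hN i) (hφ i)),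
    ENNReal.ofReal_sum_of_nonneg fun i _ => mul_nonneg (hN i) (hφ i)]
  gcongr with i
  rw [ENNReal.ofReal_mul (hN i)]
  gcongr
  exact hM i

/-- Upper bounds for the masses of the steps of `runAutomaton`, given the probabilities `g` of the
kinds of group pairs. -/
noncomputable def runBound (ρ : ℝ) (g : Bool → Bool → ℝ) : RunState → RunState → ℝ
  | .run s, .run s' => (1 + ρ / 100) ^ 2 * g s s'
  | .fresh, .run s' => (1 + ρ / 100) ^ 2 * g false s'
  | .run _, .closed | .fresh, .closed => 21 / 10 * ρ
  | .closed, .fresh | .fresh, .fresh => 1 / 200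
  | .run _, .fresh | .closed, .run _ | .closed, .closed => 0

theorem runBound_nonneg {ρ : ℝ} (hρ : 0 ≤ ρ) {g : Bool → Bool → ℝ} (hg : ∀ s s', 0 ≤ g s s')
    (s s' : RunState) : 0 ≤ runBound ρ g s s' := by
  rcases s with s | _ | _ <;> rcases s' with s' | _ | _ <;> simp only [runBound] <;>
  first | positivity | exact mul_nonneg (by positivity) (hg _ _)

/-- A potential for the mean total weights of `runAutomaton`. After a shift pair, only a rich pair,
which has probability `O(ρ)`, allows another shift pair, which is why a run in which a shift pair
has been read is worth less. -/
noncomputable def runPotential : RunState → ℝ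
  | .run false => 1
  | .run true => 3 / 4
  | .closed => 1 / 50
  | .fresh => 2

theorem runPotential_nonneg (s : RunState) : 0 ≤ runPotential s := by
  rcases s with (_ | _) | _ | _ <;> norm_num [runPotential]

theorem runPotential_supersolution {ρ : ℝ} (hρ0 : 0 ≤ ρ) (hρ1 : ρ ≤ 1 / 1000)
    {g : Bool → Bool → ℝ} (hg : ∀ s s', 0 ≤ g s s') (hsum : g false false + g false true ≤ 1)
    (hsplit : g false false = g true false + g true true) (hrich : g true false ≤ 201 / 100 * ρ)
    (hshift : 99 / 100 * ρ ≤ g false true) (s : RunState) :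
    ρ / 100 + ∑ s', runBound ρ g s s' * runPotential s' ≤ runPotential s := by
  have hG : (1 + ρ / 100) ^ 2 ≤ 1 + ρ / 40 := by nlinarith
  have hunshifted : (1 + ρ / 100) ^ 2 * (g false false + g false true * (3 / 4)) ≤
      (1 + ρ / 40) * (1 - g false true / 4) := by
    gcongr
    · linarith [hg false false, hg false true]
    · linarith
  have hshifted : (1 + ρ / 100) ^ 2 * (g true false + g true true * (3 / 4)) ≤
      (1 + ρ / 40) * (3 / 4 - ρ / 5) := by
    gcongr
    · linarith [hg true false, hg true true]
    · linarith
  rw [RunState.sum_eq]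
  rcases s with (_ | _) | _ | _ <;> simp only [runBound, runPotential]
  · nlinarith
  · nlinarith
  · linarith
  · nlinarith

variable {A : Type*} [DecidableEq A] {o : A} {P : A → ℝ≥0∞} {q ρ : ℝ}

variable (o P) in
/-- The probability of the group pairs that change the flag of `GroupStep` from `s` to `s'`. -/
noncomputable def groupProb (s s' : Bool) : ℝ := (groupMass o P (GroupStep o s s')).toReal

theorem groupProb_nonneg (s s' : Bool) : 0 ≤ groupProb o P s s' := ENNReal.toReal_nonneg

variable [Fintype A]

theorem IsLaw.ofReal_groupProb (hP : IsLaw o P) (s s' : Bool) :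
    ENNReal.ofReal (groupProb o P s s') = groupMass o P (GroupStep o s s') :=
  ENNReal.ofReal_toReal (ne_top_of_le_ne_top ENNReal.one_ne_top (hP.groupMass_le_one _))

theorem IsLaw.groupProb_false_add_le_one (hP : IsLaw o P) :
    groupProb o P false false + groupProb o P false true ≤ 1 := by
  rw [← ENNReal.ofReal_le_one, ENNReal.ofReal_add (groupProb_nonneg _ _) (groupProb_nonneg _ _),
    hP.ofReal_groupProb, hP.ofReal_groupProb]
  exact hP.groupMass_not_shiftPair_add_le_one

theorem IsLaw.groupProb_false_false (hP : IsLaw o P) :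
    groupProb o P false false = groupProb o P true false + groupProb o P true true := by
  have hfinite (s s' : Bool) : groupMass o P (GroupStep o s s') ≠ ⊤ :=
    ne_top_of_le_ne_top ENNReal.one_ne_top (hP.groupMass_le_one _)
  rw [groupProb, groupProb, groupProb, ← ENNReal.toReal_add (hfinite _ _) (hfinite _ _)]
  exact congrArg _ groupMass_not_shiftPair

theorem IsLaw.groupProb_rich_le (hP : IsLaw o P) (hq : P o = ENNReal.ofReal q)
    (hq1 : 999 / 1000 ≤ q) (hρ : coincidence o P = ENNReal.ofReal ρ) (hρ0 : 0 ≤ ρ) :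
    groupProb o P true false ≤ 201 / 100 * ρ := by
  have h : ENNReal.ofReal (groupProb o P true false) ≤ ENNReal.ofReal (2 * (ρ * q⁻¹ ^ 2)) := by
    rw [hP.ofReal_groupProb, ENNReal.ofReal_mul zero_le_two, ENNReal.ofReal_mul hρ0,
      ENNReal.ofReal_pow (by rw [inv_nonneg]; linarith),
      ENNReal.ofReal_inv_of_pos (by linarith), ← hρ, ← hq, ENNReal.ofReal_ofNat]
    exact hP.groupMass_richPair_le
  rw [ENNReal.ofReal_le_ofReal_iff (by positivity)] at h
  nlinarith [inv_sq_le_of_le hq1]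

theorem IsLaw.le_groupProb_shift (hP : IsLaw o P) (hq : P o = ENNReal.ofReal q)
    (hq1 : 999 / 1000 ≤ q) (hρ : coincidence o P = ENNReal.ofReal ρ) (hρ0 : 0 ≤ ρ) :
    99 / 100 * ρ ≤ groupProb o P false true := by
  have h : ENNReal.ofReal (ρ * q ^ 4) ≤ ENNReal.ofReal (groupProb o P false true) := by
    rw [hP.ofReal_groupProb, ENNReal.ofReal_mul hρ0, ENNReal.ofReal_pow (by linarith), ← hρ, ← hq]
    exact coincidence_mul_le_groupMass_shiftPair
  rw [ENNReal.ofReal_le_ofReal_iff (groupProb_nonneg _ _)] at h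
  have hq4 : (99 / 100 : ℝ) ≤ q ^ 4 := calc
    (99 / 100 : ℝ) ≤ (999 / 1000) ^ 4 := by norm_num
    _ ≤ q ^ 4 := by gcongr
  nlinarith

variable {w : SegmentWeights}

theorem IsLaw.lenSum_runAutomaton_final_le (hP : IsLaw o P) (hmatched : 1 ≤ w.matched)
    (hmatched' : w.matched ≤ 2) (hunmatched : w.unmatched ≤ 1)
    (h : P o * w.matched + rareMass P o * w.poorRare ≤ 1) (s : RunState) (n n' : ℕ) :
    lenSum P n n' ((runAutomaton o w).final s) ≤ w.final * (2 + 2) := by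
  have hshort := (hP.lenSum_short_le hmatched n n').trans hmatched'
  have hunequal := hP.lenSum_unequal_le hunmatched h n n'
  rcases s with _ | _ | _ <;> simp only [runAutomaton, lenSum_const_mul, lenSum_add] <;> gcongr
  · exact hshort.trans le_self_add
  · exact hunequal.trans le_self_add

theorem IsLaw.tsum_rareEnd_short_le (hP : IsLaw o P) (hq : P o = ENNReal.ofReal q)
    (hq1 : 999 / 1000 ≤ q) (hρ : coincidence o P = ENNReal.ofReal ρ) (hρ0 : 0 ≤ ρ)
    (hρ1 : ρ ≤ 1 / 1000) (hmatched : w.matched = ENNReal.ofReal (1 + ρ / 100)) :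
    ∑' x, wt₂ P x * rareEnd o (w.short o) x ≤ ENNReal.ofReal (21 / 10 * ρ) := by
  have hle : q⁻¹ ^ 2 * (1 + (1 + ρ / 100)) * ρ ≤ 21 / 10 * ρ := by
    gcongr
    nlinarith [inv_sq_le_of_le hq1]
  have hq0 : 0 ≤ q⁻¹ := inv_nonneg.2 (by linarith)
  rw [tsum_wt₂_mul_rareEnd]
  calc (∑' x, wt₂ P x * w.short o x) * coincidence o P
      ≤ (P o)⁻¹ ^ 2 * (1 + w.matched) * coincidence o P := by
        gcongr
        exact hP.tsum_short_le
    _ = ENNReal.ofReal (q⁻¹ ^ 2 * (1 + (1 + ρ / 100)) * ρ) := by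
        rw [ENNReal.ofReal_mul (by positivity), ENNReal.ofReal_mul (by positivity),
          ENNReal.ofReal_pow hq0, ENNReal.ofReal_inv_of_pos (by linarith),
          ENNReal.ofReal_add zero_le_one (by positivity), ENNReal.ofReal_one, hq, hρ, hmatched]
    _ ≤ ENNReal.ofReal (21 / 10 * ρ) := ENNReal.ofReal_le_ofReal hle

theorem IsLaw.tsum_runAutomaton_step_le (hP : IsLaw o P) (hq : P o = ENNReal.ofReal q)
    (hq1 : 999 / 1000 ≤ q) (hρ : coincidence o P = ENNReal.ofReal ρ) (hρ0 : 0 ≤ ρ)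
    (hρ1 : ρ ≤ 1 / 1000) (hmatched : w.matched = ENNReal.ofReal (1 + ρ / 100))
    (hunequal : ∑' x, wt₂ P x * rareEnd o (w.unequal o) x ≤ ENNReal.ofReal (1 / 200))
    (s s' : RunState) :
    ∑' x, wt₂ P x * (runAutomaton o w).step s s' x ≤
      ENNReal.ofReal (runBound ρ (groupProb o P) s s') := by
  have hshort := hP.tsum_rareEnd_short_le hq hq1 hρ hρ0 hρ1 hmatched
  have hgroup (s s' : Bool) :
      ∑' x, wt₂ P x * (w.matched ^ 2 * groupIndicator o (GroupStep o s s') x) ≤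
        ENNReal.ofReal ((1 + ρ / 100) ^ 2 * groupProb o P s s') := by
    rw [ENNReal.ofReal_mul (by positivity), ENNReal.ofReal_pow (by positivity), ← hmatched,
      hP.ofReal_groupProb, groupMass, ← ENNReal.tsum_mul_left]
    simp only [mul_left_comm, le_refl]
  rcases s with s | _ | _ <;> rcases s' with s' | _ | _ <;>
  simp only [runAutomaton, runBound, Pi.zero_apply, mul_zero, tsum_zero, zero_le, hgroup, hshort,
    hunequal]

theorem IsLaw.mul_sum_wt₂_le_two_of_isOptimal (hP : IsLaw o P) (hq : P o = ENNReal.ofReal q)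
    (hq1 : 999 / 1000 ≤ q) (hρ : coincidence o P = ENNReal.ofReal ρ) (hρ0 : 0 ≤ ρ)
    (hρ1 : ρ ≤ 1 / 1000) (hmatched : w.matched = ENNReal.ofReal (1 + ρ / 100))
    (hfinal : w.final = ENNReal.ofReal (ρ / 400)) (hunmatched : w.unmatched ≤ 1)
    (h : P o * w.matched + rareMass P o * w.poorRare ≤ 1)
    (hunequal : ∑' x, wt₂ P x * rareEnd o (w.unequal o) x ≤ ENNReal.ofReal (1 / 200))
    (n : ℕ) (t : ℝ≥0∞) (B : Finset ((Fin n → A) × (Fin n → A)))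
    (hB : ∀ x ∈ B, ∃ α : Alignment o (ofFn x.1) (ofFn x.2), α.IsOptimal ∧ t ≤ w.alignment α) :
    t * ∑ x ∈ B, wt₂ P (ofFn x.1, ofFn x.2) ≤ 2 := by
  have hone : 1 ≤ w.matched := by
    rw [hmatched, ENNReal.one_le_ofReal]
    linarith
  have htwo : w.matched ≤ 2 := by
    rw [hmatched, ← ENNReal.ofReal_ofNat]
    exact ENNReal.ofReal_le_ofReal (by linarith)
  have hC (s : RunState) (n n' : ℕ) :
      lenSum P n n' ((runAutomaton o w).final s) ≤ ENNReal.ofReal (ρ / 100) := by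
    refine (hP.lenSum_runAutomaton_final_le hone htwo hunmatched h s n n').trans_eq ?_
    rw [hfinal, show (2 + 2 : ℝ≥0∞) = ENNReal.ofReal 4 by norm_num,
      ← ENNReal.ofReal_mul (by positivity)]
    ring_nf
  have hφ (s : RunState) : ENNReal.ofReal (ρ / 100) +
      ∑ s', (∑' x, wt₂ P x * (runAutomaton o w).step s s' x) * ENNReal.ofReal (runPotential s') ≤
        ENNReal.ofReal (runPotential s) :=
    ofReal_add_sum_mul_le (by positivity)
      (hP.tsum_runAutomaton_step_le hq hq1 hρ hρ0 hρ1 hmatched hunequal s)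
      (runBound_nonneg hρ0 groupProb_nonneg s) runPotential_nonneg
      (runPotential_supersolution hρ0 hρ1 groupProb_nonneg hP.groupProb_false_add_le_one
        hP.groupProb_false_false (hP.groupProb_rich_le hq hq1 hρ hρ0)
        (hP.le_groupProb_shift hq hq1 hρ hρ0) s)
  refine (PairAutomaton.mul_sum_wt₂_le_of_reaches P hC hφ .fresh n t B fun x hx => ?_).trans_eq
    (by simp [runPotential])
  obtain ⟨α, hα, ht⟩ := hB x hx
  obtain ⟨N, hN⟩ := α.reaches_runAutomaton.1 hα
  exact ⟨N, ht.trans hN⟩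

end OptimalAlignments

/-! ### Words -/

section Words

variable {A : Type*} {n : ℕ}

theorem ofFn_comp_sublist {k : ℕ} (x : Fin n → A) {i : Fin k → Fin n} (hi : StrictMono i) :
    ofFn (fun s => x (i s)) <+ ofFn x := by
  rw [sublist_iff_exists_fin_orderEmbedding_get_eq]
  refine ⟨((Fin.castOrderIso (by simp)).toOrderEmbedding.trans
    (OrderEmbedding.ofStrictMono i hi)).trans
    (Fin.castOrderIso (by simp)).toOrderEmbedding, fun s => ?_⟩
  simp only [get_ofFn]
  rfl

theorem exists_strictMono_of_sublist_ofFn {l : List A} {x : Fin n → A} (h : l <+ ofFn x) :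
    ∃ i : Fin l.length → Fin n, StrictMono i ∧ ∀ s, x (i s) = l.get s := by
  obtain ⟨f, hf⟩ := sublist_iff_exists_fin_orderEmbedding_get_eq.1 h
  refine ⟨fun s => Fin.cast (by simp) (f s), fun _ _ hst => f.strictMono hst, fun s => ?_⟩
  rw [hf s, get_ofFn]

theorem commonSublist_ofFn_iff (x y : Fin n → A) (k : ℕ) :
    CommonSublist (ofFn x) (ofFn y) k ↔ HasCommonSubseq x y k := by
  constructor
  · rintro ⟨l, hx, hy, hl⟩
    obtain ⟨i, hi, hxi⟩ := exists_strictMono_of_sublist_ofFn hx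
    obtain ⟨j, hj, hyj⟩ := exists_strictMono_of_sublist_ofFn hy
    exact ⟨i ∘ Fin.castLE hl, j ∘ Fin.castLE hl, hi.comp (Fin.strictMono_castLE hl),
      hj.comp (Fin.strictMono_castLE hl), fun s => (hxi _).trans (hyj _).symm⟩
  · rintro ⟨i, j, hi, hj, hij⟩
    refine ⟨ofFn fun s => x (i s), ofFn_comp_sublist x hi, ?_, by simp⟩
    rw [show (fun s => x (i s)) = fun s => y (j s) from funext hij]
    exact ofFn_comp_sublist y hj

theorem bddAbove_hasCommonSubseq (x y : Fin n → A) : BddAbove {k | HasCommonSubseq x y k} :=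
  ⟨n, fun _ ⟨_, _, hi, _, _⟩ => by simpa using Fintype.card_le_of_injective _ hi.injective⟩

theorem hasCommonSubseq_lc (x y : Fin n → A) : HasCommonSubseq x y (lc x y) :=
  Nat.sSup_mem (s := {k | HasCommonSubseq x y k})
    ⟨0, Fin.elim0, Fin.elim0, fun s => s.elim0, fun s => s.elim0, fun s => s.elim0⟩
    (bddAbove_hasCommonSubseq x y)

theorem commonSublist_ofFn_iff_le_lc {x y : Fin n → A} {k : ℕ} :
    CommonSublist (ofFn x) (ofFn y) k ↔ k ≤ lc x y := by
  refine ⟨fun h => ?_, fun h => ((commonSublist_ofFn_iff x y _).2 (hasCommonSubseq_lc x y)).mono h⟩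
  exact le_csSup (bddAbove_hasCommonSubseq x y) ((commonSublist_ofFn_iff x y k).1 h)

theorem lc_comm (x y : Fin n → A) : lc x y = lc y x :=
  eq_of_forall_le_iff fun k => by
    rw [← commonSublist_ofFn_iff_le_lc, ← commonSublist_ofFn_iff_le_lc]
    exact ⟨CommonSublist.symm, CommonSublist.symm⟩

theorem ofFn_update (x : Fin n → A) (i : Fin n) (a : A) :
    ofFn (Function.update x i a) = (ofFn x).set i a := by
  refine ext_getElem (by simp) fun j _ _ => ?_
  simp only [List.getElem_ofFn, getElem_set, Function.update_apply, Fin.ext_iff, eq_comm]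

theorem lc_update_le (x y : Fin n → A) (i : Fin n) (a : A) :
    lc (Function.update x i a) y ≤ lc x y + 1 := by
  rcases hk : lc (Function.update x i a) y with _ | k
  · exact Nat.zero_le _
  · refine Nat.succ_le_succ (commonSublist_ofFn_iff_le_lc.1 (.of_set (i := i) (c := a) ?_))
    rw [← ofFn_update]
    exact commonSublist_ofFn_iff_le_lc.2 hk.ge

theorem getD_ofFn (x : Fin n → A) (i : Fin n) (a : A) : (ofFn x).getD i a = x i := by
  simp

theorem natCount_eq_ncard (p : ℕ → Prop) [DecidablePred p] (n : ℕ) :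
    Nat.count p n = {i : Fin n | p i}.ncard := by
  rw [Nat.count_eq_card_filter_range, ← Set.ncard_coe_finset,
    ← Set.ncard_image_of_injective _ Fin.val_injective]
  congr 1
  ext i
  simp [Fin.exists_iff, and_comm]

theorem ncard_eq_ncard_inl_add_ncard_inr {B C : Type*} [Finite B] [Finite C] (S : Set (B ⊕ C)) :
    S.ncard = {b | Sum.inl b ∈ S}.ncard + {c | Sum.inr c ∈ S}.ncard := by
  conv_lhs => rw [← Set.image_preimage_inl_union_image_preimage_inr S]
  rw [Set.ncard_union_eq Set.disjoint_image_inl_image_inr,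
    Set.ncard_image_of_injective _ Sum.inl_injective,
    Set.ncard_image_of_injective _ Sum.inr_injective]
  rfl

/-- The number of positions of the two words at which writing `a` replaces a different letter and
changes the length of the longest common subsequence by `d`. -/
noncomputable def changeCount (a : A) (x y : Fin n → A) (d : ℤ) : ℕ :=
  {s ∈ otherPositions a x y |
    (lc (changeAt a x y s).1 (changeAt a x y s).2 : ℤ) - lc x y = d}.ncard

theorem changeCount_eq (a : A) (x y : Fin n → A) (d : ℤ) :
    changeCount a x y d =
      {i | x i ≠ a ∧ (lc (Function.update x i a) y : ℤ) - lc x y = d}.ncard +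
      {i | y i ≠ a ∧ (lc (Function.update y i a) x : ℤ) - lc y x = d}.ncard := by
  rw [changeCount, ncard_eq_ncard_inl_add_ncard_inr, lc_comm y x]
  simp only [lc_comm _ x]
  rfl

variable [DecidableEq A] (a : A)

theorem rares_ofFn (x : Fin n → A) : rares a (ofFn x) = {i | x i ≠ a}.ncard := by
  rw [← count_getD_ne, length_ofFn, natCount_eq_ncard]
  simp only [getD_ofFn]

theorem gainCount_ofFn (x y : Fin n → A) :
    gainCount a (ofFn x) (ofFn y) (lc x y) =
      {i | x i ≠ a ∧ lc x y < lc (Function.update x i a) y}.ncard := by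
  rw [gainCount, length_ofFn, natCount_eq_ncard]
  simp only [getD_ofFn, ← ofFn_update, commonSublist_ofFn_iff_le_lc, Nat.succ_le_iff]

theorem lossCount_ofFn (x y : Fin n → A) :
    lossCount a (ofFn x) (ofFn y) (lc x y) =
      {i | x i ≠ a ∧ lc (Function.update x i a) y < lc x y}.ncard := by
  rw [lossCount, length_ofFn, natCount_eq_ncard]
  simp only [getD_ofFn, ← ofFn_update, commonSublist_ofFn_iff_le_lc, not_le]

theorem ncard_otherPositions (x y : Fin n → A) :
    (otherPositions a x y).ncard = rares a (ofFn x) + rares a (ofFn y) := by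
  rw [ncard_eq_ncard_inl_add_ncard_inr, rares_ofFn, rares_ofFn]
  rfl

theorem gainCount_add_gainCount_le_changeCount (x y : Fin n → A) :
    gainCount a (ofFn x) (ofFn y) (lc x y) + gainCount a (ofFn y) (ofFn x) (lc x y) ≤
      changeCount a x y 1 := by
  rw [changeCount_eq, gainCount_ofFn, lc_comm x y, gainCount_ofFn, lc_comm y x]
  have hgain (x y : Fin n → A) : {i | x i ≠ a ∧ lc x y < lc (Function.update x i a) y} ⊆
      {i | x i ≠ a ∧ (lc (Function.update x i a) y : ℤ) - lc x y = 1} := by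
    rintro i ⟨hi, hlt⟩
    have := lc_update_le x y i a
    exact ⟨hi, by omega⟩
  simpa only [lc_comm y x] using
    Nat.add_le_add (Set.ncard_le_ncard (hgain x y)) (Set.ncard_le_ncard (hgain y x))

theorem changeCount_neg_one_le_lossCount_add_lossCount (x y : Fin n → A) :
    changeCount a x y (-1) ≤
      lossCount a (ofFn x) (ofFn y) (lc x y) + lossCount a (ofFn y) (ofFn x) (lc x y) := by
  rw [changeCount_eq, lossCount_ofFn, lc_comm x y, lossCount_ofFn, lc_comm y x]
  have hloss (x y : Fin n → A) :
      {i | x i ≠ a ∧ (lc (Function.update x i a) y : ℤ) - lc x y = -1} ⊆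
        {i | x i ≠ a ∧ lc (Function.update x i a) y < lc x y} :=
    fun i ⟨hi, hd⟩ => ⟨hi, by omega⟩
  simpa only [lc_comm y x] using
    Nat.add_le_add (Set.ncard_le_ncard (hloss x y)) (Set.ncard_le_ncard (hloss y x))

end Words

section Pick

instance (n : ℕ) : DiscreteMeasurableSpace (Fin n ⊕ Fin n) :=
  ⟨fun _ => measurableSet_sum_iff.2 ⟨.of_discrete, .of_discrete⟩⟩

variable {Ω A : Type*} [MeasurableSpace Ω] [MeasurableSpace A] {μ : Measure Ω} {n : ℕ}
  {X Y : ℕ → Ω → A}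

theorem measurable_word (hX : ∀ i, Measurable (X i)) (n : ℕ) : Measurable (word X n) :=
  measurable_pi_lambda _ fun i => hX i

variable [MeasurableSingletonClass A]

theorem measurableSet_wordsEq (hX : ∀ i, Measurable (X i)) (hY : ∀ i, Measurable (Y i))
    (x y : Fin n → A) : MeasurableSet (wordsEq X Y x y) :=
  (measurable_word hX n (measurableSet_singleton x)).inter
    (measurable_word hY n (measurableSet_singleton y))

theorem uniformOn_real_apply {B : Type*} [MeasurableSpace B] [MeasurableSingletonClass B]
    [Finite B] (S T : Set B) : (uniformOn S).real T = (S ∩ T).ncard / S.ncard := by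
  rw [measureReal_def, uniformOn, cond_apply S.toFinite.measurableSet,
    Measure.count_apply_finite _ S.toFinite, Measure.count_apply_finite _ (S ∩ T).toFinite,
    ← Set.ncard_eq_toFinset_card, ← Set.ncard_eq_toFinset_card, ENNReal.toReal_mul,
    ENNReal.toReal_inv, ENNReal.toReal_natCast, ENNReal.toReal_natCast, inv_mul_eq_div]

theorem cond_changedLC_sub_LC [IsFiniteMeasure μ] (hX : ∀ i, Measurable (X i))
    (hY : ∀ i, Measurable (Y i)) (a : A) {J : Ω → Fin n ⊕ Fin n} (hJm : Measurable J)
    (hJ : IsUniformPick μ a X Y J) {x y : Fin n → A} (h : μ (wordsEq X Y x y) ≠ 0)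
    (hne : (otherPositions a x y).Nonempty) (d : ℤ) :
    (μ[|wordsEq X Y x y]).real {ω | (changedLC a X Y J ω : ℤ) - LC n X Y ω = d} =
      changeCount a x y d / (otherPositions a x y).ncard := by
  let T : Set (Fin n ⊕ Fin n) :=
    {s | (lc (changeAt a x y s).1 (changeAt a x y s).2 : ℤ) - lc x y = d}
  calc (μ[|wordsEq X Y x y]).real {ω | (changedLC a X Y J ω : ℤ) - LC n X Y ω = d}
      = (μ[|wordsEq X Y x y]).real (J ⁻¹' T) := by
        refine measureReal_congr ?_
        filter_upwards [ae_cond_mem (μ := μ) (measurableSet_wordsEq hX hY x y)] with ω ⟨hx, hy⟩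
        subst hx hy
        rfl
    _ = (uniformOn (otherPositions a x y)).real T := by
        rw [← hJ x y h hne, map_measureReal_apply hJm .of_discrete]
    _ = changeCount a x y d / (otherPositions a x y).ncard := uniformOn_real_apply _ _

end Pick

/-! ### Independent random letters -/

theorem measureReal_measure_wordsEq_eq_zero {Ω A : Type*} [MeasurableSpace Ω] [Finite A]
    (μ : Measure Ω) (X Y : ℕ → Ω → A) (n : ℕ) :
    μ.real {ω | μ (wordsEq X Y (word X n ω) (word Y n ω)) = 0} = 0 := by
  let null : Set ((Fin n → A) × (Fin n → A)) := {x | μ (wordsEq X Y x.1 x.2) = 0}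
  have hsub : {ω | μ (wordsEq X Y (word X n ω) (word Y n ω)) = 0} ⊆
      ⋃ x ∈ null, wordsEq X Y x.1 x.2 :=
    fun ω hω => Set.mem_biUnion (x := (word X n ω, word Y n ω)) hω ⟨rfl, rfl⟩
  have hnull : μ (⋃ x ∈ null, wordsEq X Y x.1 x.2) = 0 :=
    (measure_biUnion_null_iff null.toFinite.countable).2 fun x hx => hx
  rw [measureReal_def, measure_mono_null hsub hnull, ENNReal.toReal_zero]

section Law

variable {Ω A : Type*} [MeasurableSpace Ω] [MeasurableSpace A]

/-- Two independent sequences of independent letters, each letter having the law `p`. -/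
structure IsIIDPair (μ : Measure Ω) (X Y : ℕ → Ω → A) (p : A → ℝ) : Prop where
  measurable_left : ∀ i, Measurable (X i)
  measurable_right : ∀ i, Measurable (Y i)
  iIndepFun_left : iIndepFun X μ
  iIndepFun_right : iIndepFun Y μ
  indepFun : IndepFun (fun ω i => X i ω) (fun ω i => Y i ω) μ
  law_left : ∀ i a, μ.real {ω | X i ω = a} = p a
  law_right : ∀ i a, μ.real {ω | Y i ω = a} = p a

variable {μ : Measure Ω} {X Y : ℕ → Ω → A} {p : A → ℝ}

theorem IsIIDPair.nonneg (h : IsIIDPair μ X Y p) (a : A) : 0 ≤ p a :=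
  h.law_left 0 a ▸ measureReal_nonneg

theorem measure_word_eq [DiscreteMeasurableSpace A] {P : A → ℝ≥0∞} (hX : iIndepFun X μ)
    (hlaw : ∀ i a, μ {ω | X i ω = a} = P a) {n : ℕ} (x : Fin n → A) :
    μ {ω | word X n ω = x} = wt P (ofFn x) := by
  have hinter : {ω | word X n ω = x} = ⋂ i ∈ Finset.univ, X (i : Fin n) ⁻¹' {x i} := by
    ext ω
    simp [word, funext_iff]
  rw [hinter, (hX.precomp Fin.val_injective).measure_inter_preimage_eq_mul _
    fun _ _ => .of_discrete, wt, map_ofFn, prod_ofFn]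
  exact Finset.prod_congr rfl fun i _ => hlaw i (x i)

variable [IsProbabilityMeasure μ] [DiscreteMeasurableSpace A]

theorem IsIIDPair.sum_eq_one [Fintype A] (h : IsIIDPair μ X Y p) : ∑ a, p a = 1 := by
  rw [← probReal_univ (μ := μ), ← Set.preimage_univ (f := X 0), ← Finset.coe_univ,
    ← sum_measureReal_preimage_singleton _ fun a _ =>
      h.measurable_left 0 (measurableSet_singleton a)]
  exact Finset.sum_congr rfl fun a _ => (h.law_left 0 a).symm

theorem IsIIDPair.measure_wordsEq (h : IsIIDPair μ X Y p) {n : ℕ} (x y : Fin n → A) :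
    μ (wordsEq X Y x y) = wt₂ (ENNReal.ofReal ∘ p) (ofFn x, ofFn y) := by
  have hword : Measurable fun (z : ℕ → A) (i : Fin n) => z i :=
    measurable_pi_lambda _ fun i => measurable_pi_apply _
  rw [wt₂, ← measure_word_eq h.iIndepFun_left fun i a => by
      rw [← ofReal_measureReal, h.law_left, Function.comp_apply],
    ← measure_word_eq h.iIndepFun_right fun i a => by
      rw [← ofReal_measureReal, h.law_right, Function.comp_apply]]
  exact (h.indepFun.comp hword hword).measure_inter_preimage_eq_mul {x} {y}
    (measurableSet_singleton x) (measurableSet_singleton y)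

theorem IsIIDPair.measure_mem_le (h : IsIIDPair μ X Y p) {n : ℕ}
    (B : Finset ((Fin n → A) × (Fin n → A))) :
    μ {ω | (word X n ω, word Y n ω) ∈ B} ≤
      ∑ x ∈ B, wt₂ (ENNReal.ofReal ∘ p) (ofFn x.1, ofFn x.2) := by
  have hsub : {ω | (word X n ω, word Y n ω) ∈ B} ⊆ ⋃ x ∈ B, wordsEq X Y x.1 x.2 :=
    fun ω hω => Set.mem_biUnion hω ⟨rfl, rfl⟩
  refine (measure_mono hsub).trans ((measure_biUnion_finset_le _ _).trans_eq ?_)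
  exact Finset.sum_congr rfl fun x _ => h.measure_wordsEq x.1 x.2

theorem IsIIDPair.measureReal_mem_le (h : IsIIDPair μ X Y p) {n : ℕ} {t c : ℝ} (ht : 0 < t)
    (hc : 0 ≤ c) {B : Finset ((Fin n → A) × (Fin n → A))}
    (hB : ENNReal.ofReal t * ∑ x ∈ B, wt₂ (ENNReal.ofReal ∘ p) (ofFn x.1, ofFn x.2) ≤
      ENNReal.ofReal c) :
    μ.real {ω | (word X n ω, word Y n ω) ∈ B} ≤ c / t := by
  refine ENNReal.toReal_le_of_le_ofReal (by positivity) ((h.measure_mem_le B).trans ?_)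
  rwa [ENNReal.ofReal_div_of_pos ht, ENNReal.le_div_iff_mul_le (by simp [ht]) (by simp), mul_comm]

end Law

section Hoeffding

variable {Ω : Type*} [MeasurableSpace Ω] {μ : Measure Ω} [IsProbabilityMeasure μ]

theorem hasSubgaussianMGF_indicator_sub {E : Set Ω} (hE : MeasurableSet E) :
    HasSubgaussianMGF (fun ω => E.indicator 1 ω - μ.real E) ((‖(1 : ℝ) - 0‖₊ / 2) ^ 2) μ := by
  have h := hasSubgaussianMGF_of_mem_Icc (μ := μ) (X := E.indicator (1 : Ω → ℝ)) (a := 0) (b := 1)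
    (measurable_one.indicator hE).aemeasurable
    (.of_forall fun ω => ⟨Set.indicator_nonneg (fun _ _ => zero_le_one) ω,
      Set.indicator_le_self' (fun _ _ => zero_le_one) ω⟩)
  rwa [integral_indicator_one hE] at h

theorem measureReal_le_abs_sum_le_of_iIndepFun {Z : ℕ → Ω → ℝ} {c : NNReal} (hZ : iIndepFun Z μ)
    (hsub : ∀ i, HasSubgaussianMGF (Z i) c μ) (n : ℕ) {ε : ℝ} (hε : 0 ≤ ε) :
    μ.real {ω | ε ≤ |∑ i ∈ Finset.range n, Z i ω|} ≤ 2 * Real.exp (-ε ^ 2 / (2 * n * c)) := by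
  have hneg : iIndepFun (fun i => -Z i) μ := hZ.comp (fun _ z => -z) fun _ => measurable_neg
  have hupper := HasSubgaussianMGF.measure_sum_range_ge_le_of_iIndepFun hZ (n := n)
    (fun i _ => hsub i) hε
  have hlower := HasSubgaussianMGF.measure_sum_range_ge_le_of_iIndepFun hneg (n := n)
    (fun i _ => (hsub i).neg) hε
  have hsubset : {ω | ε ≤ |∑ i ∈ Finset.range n, Z i ω|} ⊆
      {ω | ε ≤ ∑ i ∈ Finset.range n, Z i ω} ∪ {ω | ε ≤ ∑ i ∈ Finset.range n, (-Z i) ω} := by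
    intro ω hω
    have hω : ε ≤ |∑ i ∈ Finset.range n, Z i ω| := hω
    simpa only [Set.mem_union, Set.mem_ofPred_eq, Pi.neg_apply, Finset.sum_neg_distrib] using
      le_abs.1 hω
  calc _ ≤ _ := (measureReal_mono hsubset).trans (measureReal_union_le _ _)
    _ ≤ _ := (add_le_add hupper hlower).trans_eq (two_mul _).symm

end Hoeffding

section Count

variable {Ω A : Type*} [DecidableEq A] (o : A)

theorem count_ofFn_word (X : ℕ → Ω → A) (n : ℕ) (ω : Ω) :
    ((ofFn (word X n ω)).count o : ℝ) =
      ∑ i ∈ Finset.range n, (X i ⁻¹' {o}).indicator 1 ω := by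
  induction n with
  | zero => simp
  | succ n ih =>
    rw [Finset.sum_range_succ, ← ih, ofFn_succ', concat_eq_append, count_append, Nat.cast_add]
    congr 1
    by_cases h : X n ω = o <;> simp [word, h]

variable [MeasurableSpace Ω] {μ : Measure Ω} [IsProbabilityMeasure μ]
  [MeasurableSpace A] [MeasurableSingletonClass A] {X : ℕ → Ω → A}

theorem measureReal_le_abs_count_sub_le (hXm : ∀ i, Measurable (X i)) (hX : iIndepFun X μ) {q : ℝ}
    (hlaw : ∀ i, μ.real {ω | X i ω = o} = q) (n : ℕ) {ε : ℝ} (hε : 0 ≤ ε) :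
    μ.real {ω | n * ε ≤ |((ofFn (word X n ω)).count o : ℝ) - n * q|} ≤
      2 * Real.exp (-(2 * n * ε ^ 2)) := by
  have hZ := hX.comp (fun _ a => ({o} : Set A).indicator 1 a - q)
    fun _ => (measurable_one.indicator (measurableSet_singleton o)).sub_const q
  have h := measureReal_le_abs_sum_le_of_iIndepFun hZ (fun i => hlaw i ▸
    hasSubgaussianMGF_indicator_sub (hXm i (measurableSet_singleton o))) n (ε := n * ε)
    (by positivity)
  simp only [Function.comp_def, Finset.sum_sub_distrib, Finset.sum_const, Finset.card_range,
    nsmul_eq_mul] at h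
  simp only [count_ofFn_word]
  refine h.trans_eq ?_
  congr 2
  rcases n.eq_zero_or_pos with rfl | hn
  · simp
  · norm_num
    field_simp
    norm_num

end Count

/-! ### Pairs of words without heavy alignments -/

section Deterministic

theorem exp_mul_le_one_add {c u : ℝ} (hu : -1 < u) (h : 0 ≤ u * (1 - c * (1 + u))) :
    Real.exp (c * u) ≤ 1 + u := by
  have hpos : 0 < 1 + u := by linarith
  rw [← Real.le_log_iff_exp_le hpos]
  refine le_trans ?_ (Real.one_sub_inv_le_log_of_pos hpos)
  have hinv : (1 + u)⁻¹ ≤ 1 - c * u := by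
    rw [inv_le_iff_one_le_mul₀ hpos]
    linarith
  linarith

variable {A : Type*} [DecidableEq A] {o : A} {x y : List A} {ρ s : ℝ}

/-- The parameters of a law with a very frequent letter: `s` stands for the probability of a rare
letter, `ρ` for the probability that two independent letters are the same rare letter. -/
structure IsSparse (ρ s : ℝ) : Prop where
  pos : 0 < ρ
  mul_le : 2 ^ 70 * ρ ≤ s
  le : s ≤ 1 / 2 ^ 70

theorem IsSparse.le_one_div (h : IsSparse ρ s) : ρ ≤ 1 / 10 ^ 6 := by
  linarith [h.mul_le, h.le]

theorem IsSparse.mul_div_le (h : IsSparse ρ s) : 2 ^ 30 * ρ / s ≤ 1 / 2 := by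
  have hs : 0 < s := by linarith [h.pos, h.mul_le]
  rw [div_le_iff₀ hs]
  linarith [h.pos, h.mul_le]

theorem IsSparse.natCast_mul_bounds (h : IsSparse ρ s) (n : ℕ) :
    0 ≤ n * ρ ∧ 2 ^ 70 * (n * ρ) ≤ n * s ∧ 2 ^ 70 * (n * s) ≤ n := by
  have hρ := h.pos
  have hs : n * s ≤ n * (1 / 2 ^ 70) := by gcongr; exact h.le
  have hρs : n * (2 ^ 70 * ρ) ≤ n * s := by gcongr; exact h.mul_le
  exact ⟨by positivity, by linarith, by linarith⟩

namespace Alignment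

/-- The weight of an alignment that makes the alignments with too many matched rare letters
heavy. -/
noncomputable def matchWeight (ρ : ℝ) (α : Alignment o x y) : ℝ :=
  16 ^ α.rareMatches * 2⁻¹ ^ α.unmatched * (1 - 200 * ρ) ^ α.commonMatches

/-- The weight of an alignment that makes the alignments heavy whose poorer segments contain too few
rare letters. -/
noncomputable def poorWeight (ρ s : ℝ) (α : Alignment o x y) : ℝ :=
  (1 + ρ / 100) ^ α.commonMatches * (1 - 1 / 2 ^ 20) ^ α.unmatched *
    (1 - 2 ^ 30 * ρ / s) ^ α.poorRares

theorem size_le_length (α : Alignment o x y) : α.size ≤ x.length := by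
  obtain ⟨l, hx, -, hl⟩ := α.commonSublist
  exact hl.trans hx.length_le

theorem IsOptimal.min_count_le_size {α : Alignment o x y} (hα : α.IsOptimal) :
    min (x.count o) (y.count o) ≤ α.size :=
  hα _ (commonSublist_of_le_count o (min_le_left _ _) (min_le_right _ _))

theorem IsOptimal.unmatched_le {α : Alignment o x y} (hα : α.IsOptimal) :
    α.unmatched ≤ 2 * α.rareMatches + gap o x y := by
  have hmin := hα.min_count_le_size
  have hcount := α.count_add_count
  unfold size at hmin
  unfold gap Nat.dist
  omega

theorem exp_le_matchWeight {α : Alignment o x y} (h : IsSparse ρ s)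
    (hunmatched : (α.unmatched : ℝ) ≤ 2 * α.rareMatches + x.length * ρ)
    (hmatches : 200 * (x.length * ρ) ≤ α.rareMatches) :
    Real.exp (x.length * ρ) ≤ α.matchWeight ρ := by
  have hρ := h.pos
  have hρ1 := h.le_one_div
  have hcommon : (α.commonMatches : ℝ) * ρ ≤ x.length * ρ := by
    have := (Nat.le_add_left _ _).trans α.size_le_length
    gcongr
  have hone_sub : Real.exp (1002 / 1000 * (-(200 * ρ))) ≤ 1 - 200 * ρ :=
    exp_mul_le_one_add (by linarith) (by nlinarith)
  have hlog := Real.log_two_gt_d9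
  have hexponent : x.length * ρ ≤ α.rareMatches * (4 * Real.log 2) +
      α.unmatched * (-Real.log 2) + α.commonMatches * (1002 / 1000 * (-(200 * ρ))) := by
    have hu : α.unmatched * Real.log 2 ≤ (2 * α.rareMatches + x.length * ρ) * Real.log 2 := by
      gcongr
    have hm : 200 * (x.length * ρ) * (2 * Real.log 2) ≤ α.rareMatches * (2 * Real.log 2) := by
      gcongr
    have hl : (x.length * ρ) * 0.6931 ≤ (x.length * ρ) * Real.log 2 := by
      gcongr
      linarith
    have : 0 ≤ x.length * ρ := by positivity
    linarith
  calc Real.exp (x.length * ρ)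
      ≤ Real.exp (4 * Real.log 2) ^ α.rareMatches * Real.exp (-Real.log 2) ^ α.unmatched *
          Real.exp (1002 / 1000 * (-(200 * ρ))) ^ α.commonMatches := by
        simpa only [Real.exp_add, Real.exp_nat_mul] using Real.exp_le_exp.2 hexponent
    _ = 16 ^ α.rareMatches * 2⁻¹ ^ α.unmatched *
          Real.exp (1002 / 1000 * (-(200 * ρ))) ^ α.commonMatches := by
        rw [Real.exp_neg, Real.exp_log two_pos, ← Real.log_rpow two_pos,
          Real.exp_log (by positivity)]
        norm_num
    _ ≤ α.matchWeight ρ := by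
        unfold matchWeight
        gcongr

theorem exp_le_poorWeight {α : Alignment o x y} (h : IsSparse ρ s)
    (hcommon : 9 / 10 * (x.length : ℝ) ≤ α.commonMatches)
    (hunmatched : (α.unmatched : ℝ) ≤ 401 * (x.length * ρ))
    (hpoor : 2 ^ 30 * ρ / s * α.poorRares ≤ x.length * ρ / 2000) :
    Real.exp (x.length * ρ / 200) ≤ α.poorWeight ρ s := by
  have hρ := h.pos
  have hρ1 := h.le_one_div
  have hσ0 : 0 ≤ 2 ^ 30 * ρ / s := by
    have : 0 < s := by linarith [h.mul_le]
    positivity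
  have hσ := h.mul_div_le
  set σ := 2 ^ 30 * ρ / s
  have hgain : Real.exp (99 / 100 * (ρ / 100)) ≤ 1 + ρ / 100 :=
    exp_mul_le_one_add (by linarith) (by nlinarith)
  have hunmatched' : Real.exp (2 * (-(1 / 2 ^ 20))) ≤ 1 - 1 / 2 ^ 20 :=
    exp_mul_le_one_add (by norm_num) (by norm_num)
  have hpoor' : Real.exp (2 * (-σ)) ≤ 1 - σ :=
    exp_mul_le_one_add (by linarith) (by nlinarith)
  have hexponent : x.length * ρ / 200 ≤ α.commonMatches * (99 / 100 * (ρ / 100)) +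
      α.unmatched * (2 * (-(1 / 2 ^ 20))) + α.poorRares * (2 * (-σ)) := by
    have hc : 9 / 10 * (x.length : ℝ) * ρ ≤ α.commonMatches * ρ := by gcongr
    have : 0 ≤ x.length * ρ := by positivity
    linarith
  calc Real.exp (x.length * ρ / 200)
      ≤ Real.exp (99 / 100 * (ρ / 100)) ^ α.commonMatches *
          Real.exp (2 * (-(1 / 2 ^ 20))) ^ α.unmatched * Real.exp (2 * (-σ)) ^ α.poorRares := by
        simpa only [Real.exp_add, Real.exp_nat_mul] using Real.exp_le_exp.2 hexponent
    _ ≤ α.poorWeight ρ s := by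
        have : (0 : ℝ) ≤ 1 - 1 / 2 ^ 20 := by norm_num
        unfold poorWeight
        gcongr

end Alignment

/-- A pair of words of the same length with typical numbers of rare letters and without heavy
alignments. -/
structure IsRegular (o : A) (ρ s : ℝ) (x y : List A) : Prop where
  length_eq : x.length = y.length
  rares_left : |(rares o x : ℝ) - x.length * s| ≤ x.length * (ρ / 2)
  rares_right : |(rares o y : ℝ) - x.length * s| ≤ x.length * (ρ / 2)
  matchWeight_lt : ∀ α : Alignment o x y, α.matchWeight ρ < Real.exp (x.length * ρ)
  poorWeight_lt : ∀ α : Alignment o x y, α.IsOptimal →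
    α.poorWeight ρ s < Real.exp (x.length * ρ / 200)

namespace IsRegular

theorem unmatched_le (hxy : IsRegular o ρ s x y) {α : Alignment o x y} (hα : α.IsOptimal) :
    (α.unmatched : ℝ) ≤ 2 * α.rareMatches + x.length * ρ := by
  have hgap : (gap o x y : ℝ) ≤ x.length * ρ := by
    have hx : (x.count o : ℝ) + rares o x = x.length := mod_cast count_add_rares o x
    have hy : (y.count o : ℝ) + rares o y = x.length :=
      mod_cast (count_add_rares o y).trans hxy.length_eq.symm
    have hrx := abs_le.1 hxy.rares_left
    have hry := abs_le.1 hxy.rares_right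
    rcases le_total (x.count o) (y.count o) with hle | hle
    · rw [gap, Nat.dist_eq_sub_of_le hle, Nat.cast_sub hle]
      linarith
    · rw [gap, Nat.dist_eq_sub_of_le_right hle, Nat.cast_sub hle]
      linarith
  calc (α.unmatched : ℝ) ≤ 2 * α.rareMatches + gap o x y := mod_cast hα.unmatched_le
    _ ≤ _ := by gcongr

variable (h : IsSparse ρ s) (hxy : IsRegular o ρ s x y)
include h hxy

theorem le_rares_add_rares : 199 / 100 * (x.length * s) ≤ (rares o x + rares o y : ℕ) := by
  have hn := h.natCast_mul_bounds x.length
  push_cast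
  linarith [(abs_le.1 hxy.rares_left).1, (abs_le.1 hxy.rares_right).1]

theorem rares_add_rares_le : (rares o x + rares o y : ℕ) ≤ 21 / 10 * (x.length * s) := by
  have hn := h.natCast_mul_bounds x.length
  push_cast
  linarith [(abs_le.1 hxy.rares_left).2, (abs_le.1 hxy.rares_right).2]

theorem rareMatches_lt {α : Alignment o x y} (hα : α.IsOptimal) :
    α.rareMatches < 200 * (x.length * ρ) := by
  by_contra! hmany
  exact (hxy.matchWeight_lt α).not_ge (α.exp_le_matchWeight h (hxy.unmatched_le hα) hmany)

theorem le_commonMatches {α : Alignment o x y} (hα : α.IsOptimal) :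
    9 / 10 * (x.length : ℝ) ≤ α.commonMatches := by
  have hn := h.natCast_mul_bounds x.length
  have hsize : x.length ≤ α.size + (rares o x + rares o y) := by
    have := hα.min_count_le_size
    have := count_add_rares o x
    have := count_add_rares o y
    have := hxy.length_eq
    omega
  have hsize' : (x.length : ℝ) ≤
      α.rareMatches + α.commonMatches + (rares o x + rares o y : ℕ) := by
    exact_mod_cast hsize
  linarith [hxy.rares_add_rares_le h, hxy.rareMatches_lt h hα]

theorem le_poorRares {α : Alignment o x y} (hα : α.IsOptimal) :
    1 / 2 ^ 70 * (rares o x + rares o y : ℕ) ≤ (α.poorRares : ℝ) := by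
  by_contra! hfew
  refine (hxy.poorWeight_lt α hα).not_ge (α.exp_le_poorWeight h (hxy.le_commonMatches h hα) ?_ ?_)
  · linarith [hxy.unmatched_le hα, hxy.rareMatches_lt h hα]
  · have hρ := h.pos
    have hs : 0 < s := by linarith [h.mul_le]
    calc 2 ^ 30 * ρ / s * α.poorRares
        ≤ 2 ^ 30 * ρ / s * (1 / 2 ^ 70 * (21 / 10 * (x.length * s))) := by
          gcongr
          exact hfew.le.trans (by gcongr; exact hxy.rares_add_rares_le h)
      _ = 2 ^ 30 / 2 ^ 70 * (21 / 10) * (x.length * ρ) := by field_simp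
      _ ≤ x.length * ρ / 2000 := by linarith [h.natCast_mul_bounds x.length]

theorem le_gainCount_add_gainCount {v : ℕ} (hv : CommonSublist x y v) (hmax : MaxCommon x y v) :
    1 / 2 ^ 70 * (rares o x + rares o y : ℕ) ≤
      ((gainCount o x y v + gainCount o y x v : ℕ) : ℝ) := by
  obtain ⟨α, rfl, hα⟩ := Alignment.exists_isOptimal o hv hmax
  exact (hxy.le_poorRares h hα).trans (mod_cast α.poorRares_le_gainCount)

theorem lossCount_add_lossCount_le {v : ℕ} (hv : CommonSublist x y v) (hmax : MaxCommon x y v) :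
    ((lossCount o x y v + lossCount o y x v : ℕ) : ℝ) ≤
      202 * ρ / s * (rares o x + rares o y : ℕ) := by
  obtain ⟨α, rfl, hα⟩ := Alignment.exists_isOptimal o hv hmax
  have hρ := h.pos
  have hs : 0 < s := by linarith [h.mul_le]
  calc ((lossCount o x y α.size + lossCount o y x α.size : ℕ) : ℝ)
      ≤ α.rareMatches + α.rareMatches := mod_cast add_le_add α.lossCount_le.1 α.lossCount_le.2
    _ ≤ 202 * (199 / 100) * (x.length * ρ) := by
        linarith [hxy.rareMatches_lt h hα, h.natCast_mul_bounds x.length]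
    _ = 202 * ρ / s * (199 / 100 * (x.length * s)) := by field_simp
    _ ≤ _ := by gcongr; exact hxy.le_rares_add_rares h

end IsRegular

end Deterministic

/-! ### Heavy alignments are improbable -/

section HeavyAlignments

variable {A : Type*} [DecidableEq A] {o : A} {P : A → ℝ≥0∞} {ρ s : ℝ}

theorem IsSparse.rare_pos (h : IsSparse ρ s) : 0 < s := by
  linarith [h.pos, h.mul_le]

theorem IsSparse.two_mul_inv_mul_le (h : IsSparse ρ s) :
    2 * ((1 - s)⁻¹ * (1 - (1 - 1 / 2 ^ 20))⁻¹ * ((1 - s + 2 ^ 30 * ρ)⁻¹ *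
      (1 - (1 - s) * (1 + ρ / 100) * (1 - s + 2 ^ 30 * ρ)⁻¹)⁻¹)) * ρ ≤ 1 / 200 := by
  have hρ := h.pos
  have hs : 0 < 1 - s := by linarith [h.le]
  have : 0 < 1 - s + 2 ^ 30 * ρ := by positivity
  have hinv : (1 - s)⁻¹ ≤ 2 := by
    rw [inv_le_comm₀ hs two_pos]
    linarith [h.le]
  have hgap : (2 ^ 30 - 1) * ρ ≤ 1 - s + 2 ^ 30 * ρ - (1 - s) * (1 + ρ / 100) := by
    linarith [mul_pos h.rare_pos hρ]
  have hgap_pos : 0 < (2 ^ 30 - 1) * ρ := by norm_num; positivity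
  have hgap_inv := inv_nonneg.2 (hgap_pos.le.trans hgap)
  have hinv_mul : (1 - s + 2 ^ 30 * ρ)⁻¹ *
      (1 - (1 - s) * (1 + ρ / 100) * (1 - s + 2 ^ 30 * ρ)⁻¹)⁻¹ =
      (1 - s + 2 ^ 30 * ρ - (1 - s) * (1 + ρ / 100))⁻¹ := by
    rw [← mul_inv]
    congr 1
    field_simp
  calc _ = 2 * ((1 - s)⁻¹ * (1 - (1 - 1 / 2 ^ 20))⁻¹ *
        (1 - s + 2 ^ 30 * ρ - (1 - s) * (1 + ρ / 100))⁻¹) * ρ := by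
        rw [hinv_mul]
    _ ≤ 2 * (2 * (1 - (1 - 1 / 2 ^ 20))⁻¹ * ((2 ^ 30 - 1) * ρ)⁻¹) * ρ := by gcongr
    _ = 4 * (1 - (1 - 1 / 2 ^ 20))⁻¹ * (2 ^ 30 - 1)⁻¹ := by field_simp; norm_num
    _ ≤ 1 / 200 := by norm_num

/-- The weights of segments behind `Alignment.poorWeight`. -/
noncomputable def poorSegmentWeights (ρ s : ℝ) : SegmentWeights where
  matched := ENNReal.ofReal (1 + ρ / 100)
  unmatched := ENNReal.ofReal (1 - 1 / 2 ^ 20)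
  poorRare := ENNReal.ofReal (1 - 2 ^ 30 * ρ / s)
  final := ENNReal.ofReal (ρ / 400)

theorem IsSparse.alignment_poorSegmentWeights (h : IsSparse ρ s) {x y : List A}
    (α : Alignment o x y) :
    (poorSegmentWeights ρ s).alignment α = ENNReal.ofReal (ρ / 400 * α.poorWeight ρ s) := by
  have hρ := h.pos
  have hσ : 0 ≤ 1 - 2 ^ 30 * ρ / s := by linarith [h.mul_div_le]
  have hδ : (0 : ℝ) ≤ 1 - 1 / 2 ^ 20 := by norm_num
  rw [Alignment.poorWeight, SegmentWeights.alignment, ENNReal.ofReal_mul (by positivity),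
    ENNReal.ofReal_mul (by positivity), ENNReal.ofReal_mul (by positivity),
    ENNReal.ofReal_pow (by positivity), ENNReal.ofReal_pow hδ, ENNReal.ofReal_pow hσ]
  rfl

theorem one_sub_ofReal {r : ℝ} (hr : 0 ≤ r) : 1 - ENNReal.ofReal r = ENNReal.ofReal (1 - r) := by
  rw [ENNReal.ofReal_sub _ hr, ENNReal.ofReal_one]

theorem ofReal_matchWeight (hρ : ρ ≤ 1 / 200) {x y : List A} (α : Alignment o x y) :
    ENNReal.ofReal (α.matchWeight ρ) = 16 ^ α.rareMatches * 2⁻¹ ^ α.unmatched *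
      ENNReal.ofReal (1 - 200 * ρ) ^ α.commonMatches := by
  rw [Alignment.matchWeight, ENNReal.ofReal_mul (by positivity),
    ENNReal.ofReal_mul (by positivity), ENNReal.ofReal_pow (by norm_num),
    ENNReal.ofReal_pow (by norm_num), ENNReal.ofReal_pow (by linarith),
    ENNReal.ofReal_inv_of_pos (by norm_num)]
  norm_num

variable [Fintype A]

/-- A probability distribution on the letters for which `s` is the probability of a rare letter and
`ρ` the probability that two independent letters are the same rare letter. -/
structure IsSparseLaw (o : A) (P : A → ℝ≥0∞) (ρ s : ℝ) : Prop extends IsLaw o P, IsSparse ρ s where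
  rareMass_eq : rareMass P o = ENNReal.ofReal s
  coincidence_eq : coincidence o P = ENNReal.ofReal ρ

theorem IsSparseLaw.apply_eq (h : IsSparseLaw o P ρ s) : P o = ENNReal.ofReal (1 - s) := by
  rw [ENNReal.ofReal_sub _ h.rare_pos.le, ENNReal.ofReal_one, ← h.rareMass_eq, ← h.rareMass_add]
  exact (ENNReal.add_sub_cancel_left (h.rareMass_eq ▸ ENNReal.ofReal_ne_top)).symm

variable (h : IsSparseLaw o P ρ s)
include h

theorem IsSparseLaw.mul_sum_wt₂_le_two (n : ℕ) (t : ℝ) (B : Finset ((Fin n → A) × (Fin n → A)))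
    (hB : ∀ x ∈ B, ∃ α : Alignment o (ofFn x.1) (ofFn x.2), t ≤ α.matchWeight ρ) :
    ENNReal.ofReal t * ∑ x ∈ B, wt₂ P (ofFn x.1, ofFn x.2) ≤ ENNReal.ofReal 2 := by
  have hρ := h.pos
  have hρ1 := h.le_one_div
  have hs : 0 < 1 - s := by linarith [h.le]
  have hmass : ρ * ((1 - s)⁻¹ ^ 2 * (64 * (1 - (1 - 200 * ρ))⁻¹)) ≤ 2⁻¹ := by
    calc _ = (1 - s)⁻¹ ^ 2 * (64 / 200) := by
          rw [sub_sub_cancel]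
          field_simp
      _ ≤ 2⁻¹ := by linarith [inv_sq_le_of_le (q := 1 - s) (by linarith [h.le])]
  rw [ENNReal.ofReal_ofNat]
  refine h.toIsLaw.mul_sum_wt₂_le_two (ζ := ENNReal.ofReal (1 - 200 * ρ))
    (ENNReal.ofReal_le_one.2 (by linarith)) ?_ n _ B fun x hx => ?_
  · convert ENNReal.ofReal_le_ofReal hmass using 1
    · rw [h.coincidence_eq, h.apply_eq, ENNReal.ofReal_mul hρ.le,
        ENNReal.ofReal_mul (by positivity), ENNReal.ofReal_pow (by positivity),
        ENNReal.ofReal_mul (by norm_num), ENNReal.ofReal_inv_of_pos hs,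
        ENNReal.ofReal_inv_of_pos (by linarith), one_sub_ofReal (by linarith), ENNReal.ofReal_ofNat]
    · rw [ENNReal.ofReal_inv_of_pos two_pos, ENNReal.ofReal_ofNat]
  · obtain ⟨α, hα⟩ := hB x hx
    exact ⟨α, ofReal_matchWeight (ρ := ρ) (by linarith) α ▸ ENNReal.ofReal_le_ofReal hα⟩

theorem IsSparseLaw.tsum_rareEnd_unequal_le :
    ∑' x, wt₂ P x * rareEnd o ((poorSegmentWeights ρ s).unequal o) x ≤
      ENNReal.ofReal (1 / 200) := by
  have hρ := h.pos
  have hs : 0 < 1 - s := by linarith [h.le]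
  have hD : 0 < 1 - s + 2 ^ 30 * ρ := by positivity
  have hsσ : 0 ≤ s * (1 - 2 ^ 30 * ρ / s) :=
    mul_nonneg h.rare_pos.le (by linarith [h.mul_div_le])
  have hratio : 0 < 1 - (1 - s) * (1 + ρ / 100) * (1 - s + 2 ^ 30 * ρ)⁻¹ := by
    rw [sub_pos, ← div_eq_mul_inv, div_lt_one hD]
    linarith [mul_pos h.rare_pos hρ]
  have hrich : 1 - rareMass P o * (poorSegmentWeights ρ s).poorRare =
      ENNReal.ofReal (1 - s + 2 ^ 30 * ρ) := by
    rw [h.rareMass_eq, poorSegmentWeights, ← ENNReal.ofReal_mul h.rare_pos.le, one_sub_ofReal hsσ,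
      mul_one_sub, mul_div_cancel₀ _ h.rare_pos.ne']
    ring_nf
  rw [tsum_wt₂_mul_rareEnd]
  calc _ ≤ 2 * ((P o)⁻¹ * (1 - (poorSegmentWeights ρ s).unmatched)⁻¹ *
        ((ENNReal.ofReal (1 - s + 2 ^ 30 * ρ))⁻¹ * (1 - P o * (poorSegmentWeights ρ s).matched *
          (ENNReal.ofReal (1 - s + 2 ^ 30 * ρ))⁻¹)⁻¹)) * coincidence o P := by
        gcongr
        exact h.tsum_unequal_le hrich
    _ = ENNReal.ofReal (2 * ((1 - s)⁻¹ * (1 - (1 - 1 / 2 ^ 20))⁻¹ * ((1 - s + 2 ^ 30 * ρ)⁻¹ *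
          (1 - (1 - s) * (1 + ρ / 100) * (1 - s + 2 ^ 30 * ρ)⁻¹)⁻¹)) * ρ) := by
        rw [h.apply_eq, h.coincidence_eq, poorSegmentWeights, ← ENNReal.ofReal_inv_of_pos hD,
          ← ENNReal.ofReal_inv_of_pos hs, ← ENNReal.ofReal_mul hs.le,
          ← ENNReal.ofReal_mul (by positivity), one_sub_ofReal (by norm_num),
          one_sub_ofReal (by positivity), ← ENNReal.ofReal_inv_of_pos (by norm_num),
          ← ENNReal.ofReal_inv_of_pos hratio, ← ENNReal.ofReal_mul (by positivity),
          ← ENNReal.ofReal_mul (by positivity),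
          ← ENNReal.ofReal_mul (mul_nonneg (inv_nonneg.2 hs.le) (by norm_num)),
          ← ENNReal.ofReal_ofNat, ← ENNReal.ofReal_mul zero_le_two, ← ENNReal.ofReal_mul' hρ.le]
    _ ≤ ENNReal.ofReal (1 / 200) :=
        ENNReal.ofReal_le_ofReal h.toIsSparse.two_mul_inv_mul_le

theorem IsSparseLaw.mul_sum_wt₂_le_two_of_isOptimal (n : ℕ) (t : ℝ)
    (B : Finset ((Fin n → A) × (Fin n → A)))
    (hB : ∀ x ∈ B, ∃ α : Alignment o (ofFn x.1) (ofFn x.2), α.IsOptimal ∧ t ≤ α.poorWeight ρ s) :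
    ENNReal.ofReal (ρ / 400 * t) * ∑ x ∈ B, wt₂ P (ofFn x.1, ofFn x.2) ≤ ENNReal.ofReal 2 := by
  have hρ := h.pos
  rw [ENNReal.ofReal_ofNat]
  refine h.toIsLaw.mul_sum_wt₂_le_two_of_isOptimal (w := poorSegmentWeights ρ s) h.apply_eq
    (by linarith [h.le]) h.coincidence_eq hρ.le (by linarith [h.le_one_div]) rfl rfl
    (ENNReal.ofReal_le_one.2 (by norm_num)) ?_ h.tsum_rareEnd_unequal_le n _ B fun x hx => ?_
  · calc P o * ENNReal.ofReal (1 + ρ / 100) + rareMass P o * ENNReal.ofReal (1 - 2 ^ 30 * ρ / s)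
        = ENNReal.ofReal ((1 - s) * (1 + ρ / 100) + s * (1 - 2 ^ 30 * ρ / s)) := by
          have hs : 0 ≤ 1 - s := by linarith [h.le]
          rw [h.apply_eq, h.rareMass_eq, ← ENNReal.ofReal_mul hs,
            ← ENNReal.ofReal_mul h.rare_pos.le, ENNReal.ofReal_add (by positivity)
              (mul_nonneg h.rare_pos.le (by linarith [h.mul_div_le]))]
      _ ≤ 1 := by
          rw [ENNReal.ofReal_le_one, mul_one_sub, mul_div_cancel₀ _ h.rare_pos.ne']
          linarith [mul_pos h.rare_pos hρ]
  · obtain ⟨α, hα, ht⟩ := hB x hx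
    refine ⟨α, hα, ?_⟩
    rw [h.alignment_poorSegmentWeights]
    gcongr

end HeavyAlignments

section Probability

variable {Ω A : Type*} [MeasurableSpace Ω] {μ : Measure Ω} [IsProbabilityMeasure μ]
  [Fintype A] [DecidableEq A] [MeasurableSpace A] [DiscreteMeasurableSpace A] {o : A}
  {X Y : ℕ → Ω → A} {p : A → ℝ} {ρ s : ℝ}
  (h : IsIIDPair μ X Y p) (hP : IsSparseLaw o (ENNReal.ofReal ∘ p) ρ s)
include h hP

theorem IsIIDPair.measureReal_exp_le_matchWeight_le (n : ℕ) :
    μ.real {ω | ∃ α : Alignment o (ofFn (word X n ω)) (ofFn (word Y n ω)),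
      Real.exp (n * ρ) ≤ α.matchWeight ρ} ≤ 2 * Real.exp (-(n * ρ)) := by
  classical
  have hB := h.measureReal_mem_le (Real.exp_pos (n * ρ)) two_pos.le <|
    hP.mul_sum_wt₂_le_two n _ (.filter (fun x => ∃ α : Alignment o (ofFn x.1) (ofFn x.2),
      Real.exp (n * ρ) ≤ α.matchWeight ρ) .univ) fun x hx => (Finset.mem_filter.1 hx).2
  simpa only [Finset.mem_filter, Finset.mem_univ, true_and, Real.exp_neg, ← div_eq_mul_inv] using hB

theorem IsIIDPair.measureReal_exp_le_poorWeight_le (n : ℕ) :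
    μ.real {ω | ∃ α : Alignment o (ofFn (word X n ω)) (ofFn (word Y n ω)), α.IsOptimal ∧
      Real.exp (n * ρ / 200) ≤ α.poorWeight ρ s} ≤ 800 / ρ * Real.exp (-(n * ρ / 200)) := by
  classical
  have hρ := hP.pos
  have hB := h.measureReal_mem_le (t := ρ / 400 * Real.exp (n * ρ / 200)) (by positivity)
    two_pos.le <| hP.mul_sum_wt₂_le_two_of_isOptimal n _ (.filter (fun x =>
      ∃ α : Alignment o (ofFn x.1) (ofFn x.2), α.IsOptimal ∧
        Real.exp (n * ρ / 200) ≤ α.poorWeight ρ s) .univ) fun x hx => (Finset.mem_filter.1 hx).2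
  simp only [Finset.mem_filter, Finset.mem_univ, true_and] at hB
  refine hB.trans_eq ?_
  rw [Real.exp_neg]
  field_simp
  norm_num

end Probability

/-! ### Regular words are typical -/

theorem exp_add_exp_add_exp_le {n ρ : ℝ} (hρ : 0 < ρ) (hρ1 : ρ ≤ 1 / 10 ^ 6)
    (hn : 1 ≤ n * ρ ^ 3 / 5) :
    4 * Real.exp (-(2 * n * (ρ / 2) ^ 2)) + 2 * Real.exp (-(n * ρ)) +
      800 / ρ * Real.exp (-(n * ρ / 200)) ≤ 7 * Real.exp (-(n * ρ ^ 3 / 5)) := by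
  have hn0 : 0 ≤ n := by
    by_contra! hneg
    linarith [mul_neg_of_neg_of_pos hneg (pow_pos hρ 3)]
  have hcube : n * ρ ^ 3 ≤ n * ρ ^ 2 * (1 / 10 ^ 6) := by
    rw [pow_succ, ← mul_assoc]
    gcongr
  have hsq : n * ρ ^ 2 ≤ n * ρ * (1 / 10 ^ 6) := by
    rw [sq, ← mul_assoc]
    gcongr
  have : 0 ≤ n * ρ ^ 2 := by positivity
  have hcount : Real.exp (-(2 * n * (ρ / 2) ^ 2)) ≤ Real.exp (-(n * ρ ^ 3 / 5)) :=
    Real.exp_le_exp.2 (by linarith)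
  have hmatch : Real.exp (-(n * ρ)) ≤ Real.exp (-(n * ρ ^ 3 / 5)) :=
    Real.exp_le_exp.2 (by linarith)
  have hpoor : 800 / ρ * Real.exp (-(n * ρ / 200)) ≤ Real.exp (-(n * ρ ^ 3 / 5)) := by
    have hfactor : 800 / ρ ≤ Real.exp (n * ρ / 400) := by
      refine le_trans ?_ ((lt_add_one _).le.trans (Real.add_one_le_exp _))
      rw [div_le_iff₀ hρ]
      linarith
    calc _ ≤ Real.exp (n * ρ / 400) * Real.exp (-(n * ρ / 200)) := by gcongr
      _ = Real.exp (-(n * ρ / 400)) := by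
        rw [← Real.exp_add]
        ring_nf
      _ ≤ _ := Real.exp_le_exp.2 (by linarith)
  linarith

section Typical

variable {Ω A : Type*} [MeasurableSpace Ω] {μ : Measure Ω} [IsProbabilityMeasure μ]
  [DecidableEq A] [MeasurableSpace A] [DiscreteMeasurableSpace A]
  {o : A} {X Y : ℕ → Ω → A} {p : A → ℝ} {ρ s : ℝ}

theorem measureReal_lt_abs_rares_sub_le (hXm : ∀ i, Measurable (X i)) (hX : iIndepFun X μ)
    (hlaw : ∀ i, μ.real {ω | X i ω = o} = 1 - s) (n : ℕ) {ε : ℝ} (hε : 0 ≤ ε) :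
    μ.real {ω | n * ε < |(rares o (ofFn (word X n ω)) : ℝ) - n * s|} ≤
      2 * Real.exp (-(2 * n * ε ^ 2)) := by
  refine (measureReal_mono fun ω hω => ?_).trans
    (measureReal_le_abs_count_sub_le o hXm hX hlaw n hε)
  have hcount : ((ofFn (word X n ω)).count o : ℝ) + rares o (ofFn (word X n ω)) = n :=
    mod_cast (count_add_rares o _).trans length_ofFn
  have heq : ((ofFn (word X n ω)).count o : ℝ) - n * (1 - s) =
      -((rares o (ofFn (word X n ω)) : ℝ) - n * s) := by linarith
  rw [Set.mem_ofPred_eq, heq, abs_neg]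
  exact (Set.mem_ofPred_eq.mp hω).le

variable [Fintype A]

theorem IsIIDPair.sum_erase (h : IsIIDPair μ X Y p) (o : A) :
    ∑ a ∈ Finset.univ.erase o, p a = 1 - p o := by
  rw [Finset.sum_erase_eq_sub (Finset.mem_univ o), h.sum_eq_one]

theorem IsIIDPair.isSparseLaw (h : IsIIDPair μ X Y p)
    (hs : ∑ a ∈ Finset.univ.erase o, p a = s) (hρ : ∑ a ∈ Finset.univ.erase o, p a ^ 2 = ρ)
    (hρ0 : 0 < ρ) (hs1 : s ≤ 1 / 2 ^ 70) : IsSparseLaw o (ENNReal.ofReal ∘ p) ρ s where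
  sum_eq_one := by
    simp only [Function.comp_apply]
    rw [← ENNReal.ofReal_sum_of_nonneg fun a _ => h.nonneg a, h.sum_eq_one, ENNReal.ofReal_one]
  ne_zero := by
    rw [Function.comp_apply, ENNReal.ofReal_ne_zero_iff]
    linarith [h.sum_erase o]
  pos := hρ0
  mul_le := by
    have hs0 : 0 ≤ s := hs ▸ Finset.sum_nonneg fun a _ => h.nonneg a
    have hsq : ρ ≤ s ^ 2 := hρ ▸ hs ▸ Finset.sum_sq_le_sq_sum_of_nonneg fun a _ => h.nonneg a
    calc 2 ^ 70 * ρ ≤ 2 ^ 70 * (1 / 2 ^ 70 * s) := by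
          gcongr
          exact hsq.trans (by rw [sq]; gcongr)
      _ = s := by ring
  le := hs1
  rareMass_eq := by
    rw [← hs, ENNReal.ofReal_sum_of_nonneg fun a _ => h.nonneg a]
    rfl
  coincidence_eq := by
    rw [← hρ, ENNReal.ofReal_sum_of_nonneg fun a _ => sq_nonneg _]
    exact Finset.sum_congr rfl fun a _ => (ENNReal.ofReal_pow (h.nonneg a) 2).symm

theorem IsIIDPair.measureReal_not_isRegular_le (h : IsIIDPair μ X Y p)
    (hP : IsSparseLaw o (ENNReal.ofReal ∘ p) ρ s) (hpo : p o = 1 - s) (n : ℕ) :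
    μ.real {ω | ¬IsRegular o ρ s (ofFn (word X n ω)) (ofFn (word Y n ω))} ≤
      4 * Real.exp (-(2 * n * (ρ / 2) ^ 2)) + 2 * Real.exp (-(n * ρ)) +
        800 / ρ * Real.exp (-(n * ρ / 200)) := by
  have hρ := hP.pos
  set left := {ω | n * (ρ / 2) < |(rares o (ofFn (word X n ω)) : ℝ) - n * s|} with hleft
  set right := {ω | n * (ρ / 2) < |(rares o (ofFn (word Y n ω)) : ℝ) - n * s|} with hright
  set matched := {ω | ∃ α : Alignment o (ofFn (word X n ω)) (ofFn (word Y n ω)),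
    Real.exp (n * ρ) ≤ α.matchWeight ρ} with hmatched
  set poor := {ω | ∃ α : Alignment o (ofFn (word X n ω)) (ofFn (word Y n ω)), α.IsOptimal ∧
    Real.exp (n * ρ / 200) ≤ α.poorWeight ρ s} with hpoor
  have hsub : {ω | ¬IsRegular o ρ s (ofFn (word X n ω)) (ofFn (word Y n ω))} ⊆
      left ∪ right ∪ (matched ∪ poor) := by
    refine fun ω hω => by_contra fun hc => hω ?_
    simp only [hleft, hright, hmatched, hpoor, Set.mem_union, Set.mem_ofPred_eq, not_or, not_lt,
      not_exists, not_and, not_le] at hc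
    obtain ⟨⟨hleft, hright⟩, hmatched, hpoor⟩ := hc
    constructor <;> simp_all only [length_ofFn, implies_true]
  calc _ ≤ μ.real (left ∪ right) + μ.real (matched ∪ poor) :=
        (measureReal_mono hsub).trans (measureReal_union_le _ _)
    _ ≤ (μ.real left + μ.real right) + (μ.real matched + μ.real poor) :=
        add_le_add (measureReal_union_le _ _) (measureReal_union_le _ _)
    _ ≤ (2 * Real.exp (-(2 * n * (ρ / 2) ^ 2)) + 2 * Real.exp (-(2 * n * (ρ / 2) ^ 2))) +
        (2 * Real.exp (-(n * ρ)) + 800 / ρ * Real.exp (-(n * ρ / 200))) := by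
      gcongr
      · exact measureReal_lt_abs_rares_sub_le h.measurable_left h.iIndepFun_left
          (fun i => (h.law_left i o).trans hpo) n (by positivity)
      · exact measureReal_lt_abs_rares_sub_le h.measurable_right h.iIndepFun_right
          (fun i => (h.law_right i o).trans hpo) n (by positivity)
      · exact h.measureReal_exp_le_matchWeight_le hP n
      · exact h.measureReal_exp_le_poorWeight_le hP n
    _ = _ := by ring

/-- The pairs of words of positive probability which are regular. -/
def typicalPairs (μ : Measure Ω) (X Y : ℕ → Ω → A) (n : ℕ) (o : A) (ρ s : ℝ) :
    Set ((Fin n → A) × (Fin n → A)) :=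
  {x | μ (wordsEq X Y x.1 x.2) ≠ 0 ∧ IsRegular o ρ s (ofFn x.1) (ofFn x.2)}

theorem IsIIDPair.le_measureReal_mem_typicalPairs (h : IsIIDPair μ X Y p)
    (hP : IsSparseLaw o (ENNReal.ofReal ∘ p) ρ s) (hpo : p o = 1 - s) {n : ℕ}
    (hn : 1 ≤ n * ρ ^ 3 / 5) :
    1 - 7 * Real.exp (-(n * ρ ^ 3 / 5)) ≤
      μ.real {ω | (word X n ω, word Y n ω) ∈ typicalPairs μ X Y n o ρ s} := by
  set typical := {ω | (word X n ω, word Y n ω) ∈ typicalPairs μ X Y n o ρ s}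
  have hmeas : MeasurableSet typical :=
    (measurable_word h.measurable_left n).prodMk (measurable_word h.measurable_right n)
      .of_discrete
  have hcompl : typicalᶜ ⊆ {ω | μ (wordsEq X Y (word X n ω) (word Y n ω)) = 0} ∪
      {ω | ¬IsRegular o ρ s (ofFn (word X n ω)) (ofFn (word Y n ω))} := by
    refine fun ω hω => or_iff_not_imp_left.2 fun hpos hreg => hω ⟨hpos, hreg⟩
  have hle : 1 - μ.real typical ≤ 7 * Real.exp (-(n * ρ ^ 3 / 5)) := by
    rw [← probReal_compl_eq_one_sub hmeas]
    refine (measureReal_mono hcompl).trans ((measureReal_union_le _ _).trans ?_)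
    rw [measureReal_measure_wordsEq_eq_zero, zero_add]
    exact (h.measureReal_not_isRegular_le hP hpo n).trans
      (exp_add_exp_add_exp_le hP.pos hP.le_one_div hn)
  linarith

end Typical

/-! ### Conditional probabilities given regular words -/

section Conditional

variable {Ω A : Type*} [MeasurableSpace Ω] {μ : Measure Ω} [IsFiniteMeasure μ]
  [DecidableEq A] {o : A} {X Y : ℕ → Ω → A} {ρ s : ℝ} {n : ℕ} {x y : Fin n → A}
  {J : Ω → Fin n ⊕ Fin n}

theorem IsRegular.ncard_otherPositions_pos (h : IsSparse ρ s)
    (hxy : IsRegular o ρ s (ofFn x) (ofFn y)) (hn : 0 < n) : 0 < (otherPositions o x y).ncard := by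
  have hs := h.rare_pos
  have hle := hxy.le_rares_add_rares h
  rw [← ncard_otherPositions, length_ofFn] at hle
  rw [← Nat.cast_pos (α := ℝ)]
  exact lt_of_lt_of_le (by positivity) hle

variable [MeasurableSpace A] [MeasurableSingletonClass A] (h : IsSparse ρ s)
  (hX : ∀ i, Measurable (X i)) (hY : ∀ i, Measurable (Y i)) (hJm : Measurable J)
  (hJ : IsUniformPick μ o X Y J) (hn : 0 < n) (hxy : (x, y) ∈ typicalPairs μ X Y n o ρ s)
include h hX hY hJm hJ hn hxy

theorem le_cond_changedLC_sub_LC_eq_one :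
    1 / 2 ^ 70 ≤ (μ[|wordsEq X Y x y]).real {ω | (changedLC o X Y J ω : ℤ) - LC n X Y ω = 1} := by
  obtain ⟨hpos, hreg⟩ := hxy
  have hcard := hreg.ncard_otherPositions_pos h hn
  rw [cond_changedLC_sub_LC hX hY o hJm hJ hpos (Set.nonempty_of_ncard_ne_zero hcard.ne'),
    le_div_iff₀ (Nat.cast_pos.2 hcard), ncard_otherPositions]
  exact (hreg.le_gainCount_add_gainCount h (commonSublist_ofFn_iff_le_lc.2 le_rfl)
    fun _ => commonSublist_ofFn_iff_le_lc.1).trans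
    (Nat.cast_le.2 (gainCount_add_gainCount_le_changeCount o x y))

theorem cond_changedLC_sub_LC_eq_neg_one_le :
    (μ[|wordsEq X Y x y]).real {ω | (changedLC o X Y J ω : ℤ) - LC n X Y ω = -1} ≤
      202 * ρ / s := by
  obtain ⟨hpos, hreg⟩ := hxy
  have hcard := hreg.ncard_otherPositions_pos h hn
  rw [cond_changedLC_sub_LC hX hY o hJm hJ hpos (Set.nonempty_of_ncard_ne_zero hcard.ne'),
    div_le_iff₀ (Nat.cast_pos.2 hcard), ncard_otherPositions]
  exact (Nat.cast_le.2 (changeCount_neg_one_le_lossCount_add_lossCount o x y)).trans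
    (hreg.lossCount_add_lossCount_le h (commonSublist_ofFn_iff_le_lc.2 le_rfl)
      fun _ => commonSublist_ofFn_iff_le_lc.1)

end Conditional

/-! ### The parameters of the theorem -/

section Parameters

theorem K₀_pos : 0 < K₀ := by
  unfold K₀
  positivity

theorem K₀_le : K₀ ≤ 1 / 2 ^ 70 := by
  have hexp : Real.exp (-67) ≤ 1 / 2 ^ 67 := by
    rw [Real.exp_neg, ← one_div, ← Nat.cast_ofNat (n := 67), ← Real.exp_one_pow]
    gcongr
    linarith [Real.exp_one_gt_d9]
  unfold K₀
  norm_num at hexp ⊢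
  linarith

theorem K_nonneg (m : ℕ) : 0 ≤ K m :=
  le_min K₀_pos.le (by positivity)

theorem K_div_le (m : ℕ) : K m / 480 ≤ 1 / 2 ^ 70 := by
  have hK : K m ≤ K₀ := min_le_left _ _
  linarith [K₀_le, K₀_pos]

theorem K₀_div_le {m : ℕ} (hm : 0 < m) : K₀ / m ≤ 1 / 2 ^ 70 :=
  (div_le_self K₀_pos.le (Nat.one_le_cast.2 hm)).trans K₀_le

variable {m : ℕ} {p : Fin m → ℝ} {j₀ : Fin m}

theorem le_maxOther {j : Fin m} (hj : j ≠ j₀) : p j ≤ maxOther p j₀ :=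
  le_ciSup (f := fun j : {j : Fin m // j ≠ j₀} => p j) (Set.finite_range _).bddAbove ⟨j, hj⟩

theorem maxOther_sq_le_sum_sq : maxOther p j₀ ^ 2 ≤ ∑ j ∈ Finset.univ.erase j₀, p j ^ 2 := by
  rcases isEmpty_or_nonempty {j : Fin m // j ≠ j₀} with hempty | hne
  · rw [maxOther, Real.iSup_of_isEmpty, zero_pow two_ne_zero]
    exact Finset.sum_nonneg fun j _ => sq_nonneg _
  · obtain ⟨⟨j, hj⟩, hmax⟩ :=
      exists_eq_ciSup_of_finite (f := fun j : {j : Fin m // j ≠ j₀} => p j)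
    rw [maxOther, ← hmax]
    exact Finset.single_le_sum (f := fun j => p j ^ 2) (fun k _ => sq_nonneg _)
      (Finset.mem_erase.2 ⟨hj, Finset.mem_univ j⟩)

theorem sum_erase_le_mul_maxOther (hp : ∀ j, 0 ≤ p j) :
    ∑ j ∈ Finset.univ.erase j₀, p j ≤ m * maxOther p j₀ :=
  calc _ ≤ ∑ _j ∈ Finset.univ.erase j₀, maxOther p j₀ :=
        Finset.sum_le_sum fun j hj => le_maxOther (Finset.ne_of_mem_erase hj)
    _ ≤ ∑ _j : Fin m, maxOther p j₀ :=
        Finset.sum_le_sum_of_subset_of_nonneg (Finset.erase_subset _ _)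
          fun _ _ _ => Real.iSup_nonneg fun j => hp j
    _ = m * maxOther p j₀ := by simp

theorem sum_sq_erase_le_maxOther_mul_sum (hp : ∀ j, 0 ≤ p j) :
    ∑ j ∈ Finset.univ.erase j₀, p j ^ 2 ≤
      maxOther p j₀ * ∑ j ∈ Finset.univ.erase j₀, p j := by
  rw [Finset.mul_sum]
  refine Finset.sum_le_sum fun j hj => ?_
  rw [sq]
  exact mul_le_mul_of_nonneg_right (le_maxOther (Finset.ne_of_mem_erase hj)) (hp j)

theorem mul_maxOther_le (hmax : maxOther p j₀ ≤ 2⁻¹ ^ 2 * Real.exp (-5) * K m / m) :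
    m * maxOther p j₀ ≤ K m / 480 := by
  have hexp : Real.exp (-5) ≤ 1 / 120 := by
    rw [Real.exp_neg, ← one_div, ← Nat.cast_ofNat (n := 5), ← Real.exp_one_pow]
    gcongr
    calc (120 : ℝ) ≤ 2.7 ^ 5 := by norm_num
      _ ≤ Real.exp 1 ^ 5 := by gcongr; linarith [Real.exp_one_gt_d9]
  rw [le_div_iff₀' (Nat.cast_pos.2 j₀.pos)] at hmax
  linarith [mul_le_mul_of_nonneg_right hexp (K_nonneg m)]

theorem mul_sum_sq_erase_div_sum_le (hp : ∀ j, 0 ≤ p j)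
    (hmax : m * maxOther p j₀ ≤ K m / 480) :
    202 * (∑ j ∈ Finset.univ.erase j₀, p j ^ 2) / ∑ j ∈ Finset.univ.erase j₀, p j ≤
      K m / (2 * m) := by
  have hm : (0 : ℝ) < m := Nat.cast_pos.2 j₀.pos
  have hmax0 : 0 ≤ maxOther p j₀ := Real.iSup_nonneg fun j => hp j
  calc _ ≤ 202 * maxOther p j₀ := by
        refine div_le_of_le_mul₀ (Finset.sum_nonneg fun j _ => hp j) (by positivity) ?_
        rw [mul_assoc]
        gcongr
        exact sum_sq_erase_le_maxOther_mul_sum hp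
    _ ≤ K m / (2 * m) := by
        rw [le_div_iff₀ (by positivity)]
        linarith [K_nonneg m]

end Parameters

end LCS

open LCS in
theorem theorem2_general {Ω A : Type*} [MeasurableSpace Ω] (μ : Measure Ω) [IsProbabilityMeasure μ]
    [Fintype A] [DecidableEq A] [MeasurableSpace A] [DiscreteMeasurableSpace A]
    {p : A → ℝ} {o : A} {X Y : ℕ → Ω → A} (h : IsIIDPair μ X Y p) {ρ s : ℝ}
    (hs : ∑ a ∈ Finset.univ.erase o, p a = s) (hρ : ∑ a ∈ Finset.univ.erase o, p a ^ 2 = ρ)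
    (hs1 : s ≤ 1 / 2 ^ 70) {n : ℕ} {J : Ω → Fin n ⊕ Fin n} (hJm : Measurable J)
    (hJ : IsUniformPick μ o X Y J) :
    ∃ B : Set ((Fin n → A) × (Fin n → A)),
      1 - 7 * Real.exp (-(n * ρ ^ 3 / 5)) ≤ μ.real {ω | (word X n ω, word Y n ω) ∈ B} ∧
      ∀ x y, (x, y) ∈ B →
        1 / 2 ^ 70 ≤
          (μ[|wordsEq X Y x y]).real {ω | (changedLC o X Y J ω : ℤ) - LC n X Y ω = 1} ∧
        (μ[|wordsEq X Y x y]).real {ω | (changedLC o X Y J ω : ℤ) - LC n X Y ω = -1} ≤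
          202 * ρ / s := by
  rcases lt_or_ge (n * ρ ^ 3 / 5) 1 with hsmall | hlarge
  · refine ⟨∅, ?_, fun x y hxy => absurd hxy (Set.notMem_empty _)⟩
    have hexp : Real.exp (-1) ≤ Real.exp (-(n * ρ ^ 3 / 5)) := Real.exp_le_exp.2 (by linarith)
    have hempty : 1 - 7 * Real.exp (-(n * ρ ^ 3 / 5)) ≤ 0 := by
      linarith [Real.exp_neg_one_gt_d9]
    exact hempty.trans measureReal_nonneg
  · have hρ0 : 0 < ρ := by
      refine lt_of_le_of_ne (hρ ▸ Finset.sum_nonneg fun a _ => sq_nonneg _) fun h0 => ?_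
      norm_num [← h0] at hlarge
    have hn : 0 < n := by
      refine Nat.pos_of_ne_zero fun h0 => ?_
      norm_num [h0] at hlarge
    have hP := h.isSparseLaw hs hρ hρ0 hs1
    exact ⟨typicalPairs μ X Y n o ρ s,
      h.le_measureReal_mem_typicalPairs hP (by linarith [h.sum_erase o]) hlarge, fun x y hxy =>
      ⟨le_cond_changedLC_sub_LC_eq_one hP.toIsSparse h.measurable_left h.measurable_right hJm hJ
        hn hxy,
      cond_changedLC_sub_LC_eq_neg_one_le hP.toIsSparse h.measurable_left h.measurable_right hJm hJ
        hn hxy⟩⟩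

theorem theorem2 {Ω : Type*} [MeasurableSpace Ω] (μ : Measure Ω) [IsProbabilityMeasure μ]
    (m : ℕ) (p : Fin m → ℝ) (j₀ : Fin m)
    (X Y : ℕ → Ω → Fin m)
    (hXm : ∀ i, Measurable (X i)) (hYm : ∀ i, Measurable (Y i))
    (hXind : iIndepFun X μ) (hYind : iIndepFun Y μ)
    (hXY : IndepFun (fun ω i => X i ω) (fun ω i => Y i ω) μ)
    (hXlaw : ∀ i k, μ.real {ω | X i ω = k} = p k)
    (hYlaw : ∀ i k, μ.real {ω | Y i ω = k} = p k)
    (hj₀ : 1 / 2 < p j₀)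
    (hmax : LCS.maxOther p j₀ ≤
      min (2⁻¹ ^ 2 * Real.exp (-5) * LCS.K m / m) (LCS.K m / (2 * m ^ 2)))
    (n : ℕ) (hn : 1 ≤ n)
    (J : Ω → Fin n ⊕ Fin n) (hJm : Measurable J)
    (hJ : LCS.IsUniformPick μ j₀ X Y J) :
    ∃ B : Set ((Fin n → Fin m) × (Fin n → Fin m)),
      1 - 121 * Real.exp (-(n * LCS.maxOther p j₀ ^ 6 / 5)) ≤
        μ.real {ω | (LCS.word X n ω, LCS.word Y n ω) ∈ B} ∧
      ∀ x y, (x, y) ∈ B →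
        LCS.K₀ / m ≤ (μ[|LCS.wordsEq X Y x y]).real
          {ω | (LCS.changedLC j₀ X Y J ω : ℤ) - LCS.LC n X Y ω = 1} ∧
        (μ[|LCS.wordsEq X Y x y]).real
          {ω | (LCS.changedLC j₀ X Y J ω : ℤ) - LCS.LC n X Y ω = -1} ≤
            LCS.K m / (2 * m) := by
  have h : LCS.IsIIDPair μ X Y p := ⟨hXm, hYm, hXind, hYind, hXY, hXlaw, hYlaw⟩
  have hmul := LCS.mul_maxOther_le (hmax.trans (min_le_left _ _))
  have hs := (LCS.sum_erase_le_mul_maxOther h.nonneg).trans (hmul.trans (LCS.K_div_le m))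
  obtain ⟨B, hB, hcond⟩ := theorem2_general μ h rfl rfl hs hJm hJ
  refine ⟨B, le_trans ?_ hB, fun x y hxy =>
    ⟨(LCS.K₀_div_le j₀.pos).trans (hcond x y hxy).1, (hcond x y hxy).2.trans ?_⟩⟩
  · gcongr
    · norm_num
    · rw [pow_mul (LCS.maxOther p j₀) 2 3]
      gcongr
      exact LCS.maxOther_sq_le_sum_sq
  · exact LCS.mul_sum_sq_erase_div_sum_le h.nonneg hmul
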